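/- **Conventions.** Let $\Pi$ be the full subcategory of the homotopy category of pointed spaces on the spaces with the pointed homotopy type of a finite (possibly empty) wedge of spheres of positive dimensions. A *$\Pi$-algebra* is a functor $A\colon \Pi^{op}\to \mathrm{Set}$ that preserves finite products (i.e. sends finite wedges to products); $\Pi\mathrm{Alg}$ is the category of $\Pi$-algebras. For $n\ge 0$, a $\Pi$-algebra $A$ is *$n$-connected* if $A(S^i)$ is a point for all $1\le i\le n$; $\iota\colon \Pi\mathrm{Alg}_{n+1}^{\infty}\to\Pi\mathrm{Alg}$ is the inclusion of the full subcategory of $n$-connected $\Pi$-algebras, and $C_n\colon \Pi\mathrm{Alg}\to\Pi\mathrm{Alg}_{n+1}^{\infty}$ is its right adjoint, the $n$-th connected cover functor, with $(C_nA)(S^i)=A(S^i)$ for $i>n$. Let $\mathcal C$ be $\Pi\mathrm{Alg}$ or $\Pi\mathrm{Alg}_{n+1}^{\infty}$. A *module* over an object $X$ of $\mathcal C$ is an abelian group object of the slice category $\mathcal C/X$. A map of simplicial objects of $\mathcal C$ is an acyclic fibration if it is one (as a map of simplicial sets) at the level of underlying graded sets $\{A(S^i)\}_i$; a cofibrant replacement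 of $X$ is a simplicial object $C_\bullet$ of $\mathcal C$ which has the left lifting property with respect to acyclic fibrations, with an acyclic fibration from $C_\bullet$ to the constant simplicial object $X$. For a module $M$ over $X$, the Quillen cohomology is $HQ^k_{\mathcal C}(X;M)=\pi^k\operatorname{Hom}_{\mathcal C/X}(C_\bullet,M)$, $k\ge 0$. If $B$ is an $n$-connected $\Pi$-algebra, then a module $M$ over $\iota B$ gives a module $C_nM$ over $B$, by applying $C_n$ and pulling back along the unit $B\to C_n\iota B$, and $\operatorname{Hom}_{/\iota B}(\iota Y,M)\cong\operatorname{Hom}_{/B}(Y,C_nM)$ for $Y$ over $B$. **Theorem (connected cover isomorphism).** Let $n\ge 0$, let $B$ be an $n$-connected $\Pi$-algebra and $M$ a module over $\iota B$. Let $P_\bullet\to \iota B$ and $Q_\bullet\to B$ be cofibrant replacements in simplicial objects of $\Pi\mathrm{Alg}$ and of $\Pi\mathrm{Alg}_{n+1}^{\infty}$. There is a map $\psi\colon\iota Q_\bullet\to P_\bullet$ of simplicial $\Pi$-algebras over $\iota B$; the map in cohomology induced by $$\operatorname{Hom}_{/\iota B}(P_\bullet,M)\xrightarrow{\psi^*}\operatorname{Hom}_{/\iota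 B}(\iota Q_\bullet,M)\cong \operatorname{Hom}_{/B}(Q_\bullet,C_nM)$$ does not depend on the choice of $\psi$; and this natural comparison map $$HQ^k_{\Pi\mathrm{Alg}}(\iota B;M)\longrightarrow HQ^k_{\Pi\mathrm{Alg}_{n+1}^{\infty}}(B;C_nM)$$ is an isomorphism for every $k\ge 0$. -/

import Mathlib

open CategoryTheory CategoryTheory.Limits Opposite

universe u

namespace PiAlgebra

/-- A pointed topological space. -/
structure PtdTop where
  /-- the underlying set -/
  carrier : Type
  [top : TopologicalSpace carrier]
  /-- the base point -/
  pt : carrier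

attribute [instance] PtdTop.top

/-- A base point preserving continuous map. -/
@[ext]
structure PtdTop.Hom (X Y : PtdTop) where
  /-- the underlying continuous map -/
  toMap : C(X.carrier, Y.carrier)
  map_pt : toMap X.pt = Y.pt

instance : Category PtdTop where
  Hom := PtdTop.Hom
  id X := ⟨ContinuousMap.id _, rfl⟩
  comp f g := ⟨g.toMap.comp f.toMap, by simp [f.map_pt, g.map_pt]⟩

/-- Pointed homotopy: homotopy relative to the base point. -/
def PtdTop.Homotopic : HomRel PtdTop := fun X _ f g =>
  ContinuousMap.HomotopicRel f.toMap g.toMap {X.pt}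

/-- The homotopy category of pointed spaces. -/
abbrev HoPtdTop := CategoryTheory.Quotient PtdTop.Homotopic

/-- The constant pointed map. -/
def PtdTop.const (X Y : PtdTop) : X ⟶ Y := PtdTop.Hom.mk (ContinuousMap.const _ Y.pt) rfl

/-- The pointed sphere `S^k`: the unit sphere of `ℝ^(k+1)`, based at the first basis vector. -/
noncomputable def PtdTop.sphere (k : ℕ) : PtdTop where
  carrier := Metric.sphere (0 : EuclideanSpace ℝ (Fin (k + 1))) 1
  pt := ⟨EuclideanSpace.single 0 1, by simp⟩

/-- The relation which identifies all base points in a disjoint union of pointed spaces with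
one additional point. -/
inductive PtdTop.WedgeRel {J : Type} (X : J → PtdTop) :
    Unit ⊕ (Σ j, (X j).carrier) → Unit ⊕ (Σ j, (X j).carrier) → Prop
  | glue (j : J) : PtdTop.WedgeRel X (Sum.inr ⟨j, (X j).pt⟩) (Sum.inl ())

/-- The wedge of a family of pointed spaces (a point if the family is empty). -/
def PtdTop.wedge {J : Type} (X : J → PtdTop) : PtdTop where
  carrier := Quot (PtdTop.WedgeRel X)
  pt := Quot.mk _ (Sum.inl ())

/-- The objects of the homotopy category of pointed spaces which have the homotopy type of a
finite (possibly empty) wedge of spheres of positive dimensions. -/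
def IsSphereWedge : ObjectProperty HoPtdTop := fun X =>
  ∃ (J : Type) (_ : Finite J) (d : J → ℕ), (∀ j, 1 ≤ d j) ∧
    Nonempty (X ≅ (Quotient.functor PtdTop.Homotopic).obj
      (PtdTop.wedge fun j => PtdTop.sphere (d j)))

/-- The category `Π`. -/
abbrev SphereCat := IsSphereWedge.FullSubcategory

/-! ### Facts about pointed homotopy -/

namespace PtdTop

@[simp] lemma id_toMap (X : PtdTop) : Hom.toMap (𝟙 X) = ContinuousMap.id _ := rfl
@[simp] lemma comp_toMap {X Y Z : PtdTop} (f : X ⟶ Y) (g : Y ⟶ Z) :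
    Hom.toMap (f ≫ g) = g.toMap.comp f.toMap := rfl

lemma hom_ext {X Y : PtdTop} {f g : X ⟶ Y} (h : ∀ x, f.toMap x = g.toMap x) : f = g :=
  Hom.ext (ContinuousMap.ext h)

/-- A constructor for pointed homotopies. -/
lemma Homotopic.mk {X Y : PtdTop} {f g : X ⟶ Y} (H : unitInterval → X.carrier → Y.carrier)
    (hH : Continuous fun p : unitInterval × X.carrier => H p.1 p.2)
    (h0 : ∀ x, H 0 x = f.toMap x) (h1 : ∀ x, H 1 x = g.toMap x)
    (hpt : ∀ t, H t X.pt = Y.pt) : Homotopic f g :=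
  ⟨{ toFun := fun p => H p.1 p.2
     continuous_toFun := hH
     map_zero_left := h0
     map_one_left := h1
     prop' := by
      rintro t x rfl
      simpa [f.map_pt] using hpt t }⟩

instance : Congruence Homotopic where
  comp_left := by
    intro _ _ _ f g g' h
    obtain ⟨H⟩ := h
    refine Homotopic.mk (fun t x => H (t, f.toMap x)) (by fun_prop) (fun x => by simp)
      (fun x => by simp) fun t => ?_
    rw [f.map_pt, H.eq_fst t rfl, g.map_pt]
  comp_right g h := h.comp_continuousMap g.toMap
  equivalence := ⟨fun _ => ContinuousMap.HomotopicRel.refl _,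
    fun h => ContinuousMap.HomotopicRel.symm h, fun h h' => ContinuousMap.HomotopicRel.trans h h'⟩

variable {J : Type} (X : J → PtdTop)

/-- The inclusion of a summand of a wedge. -/
def wedgeIncl (j : J) : X j ⟶ wedge X :=
  Hom.mk ⟨fun x => Quot.mk _ (Sum.inr ⟨j, x⟩),
    continuous_quot_mk.comp (continuous_inr.comp continuous_sigmaMk)⟩ (Quot.sound (WedgeRel.glue j))

variable {X}

lemma wedge_cases {p : (wedge X).carrier → Prop} (h0 : p (wedge X).pt)
    (h : ∀ j x, p ((wedgeIncl X j).toMap x)) (x) : p x := by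
  induction x using Quot.ind with
  | mk x =>
    rcases x with ⟨⟩ | ⟨j, x⟩
    · exact h0
    · exact h j x

/-- The map out of a wedge given by a family of maps. -/
def wedgeFun {Z : Type*} (f : ∀ j, (X j).carrier → Z) (z : Z) (hf : ∀ j, f j (X j).pt = z) :
    (wedge X).carrier → Z :=
  Quot.lift (Sum.elim (fun _ => z) fun p => f p.1 p.2) (by rintro _ _ ⟨j⟩; exact hf j)

lemma continuous_wedgeFun {Z : Type*} [TopologicalSpace Z] (f : ∀ j, (X j).carrier → Z) (z : Z)
    (hf : ∀ j, f j (X j).pt = z) (hc : ∀ j, Continuous (f j)) : Continuous (wedgeFun f z hf) :=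
  continuous_quot_lift _ (continuous_sum_dom.2 ⟨continuous_const, continuous_sigma hc⟩)

/-- The pointed map out of a wedge given by a family of pointed maps. -/
def wedgeDesc {Z : PtdTop} (f : ∀ j, X j ⟶ Z) : wedge X ⟶ Z :=
  Hom.mk ⟨wedgeFun (fun j => (f j).toMap) Z.pt fun j => (f j).map_pt,
    continuous_wedgeFun _ _ _ fun j => (f j).toMap.continuous⟩ rfl

lemma wedgeIncl_desc {Z : PtdTop} (f : ∀ j, X j ⟶ Z) (j : J) :
    wedgeIncl X j ≫ wedgeDesc f = f j := rfl

lemma wedge_hom_ext {Z : PtdTop} {f g : wedge X ⟶ Z}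
    (h : ∀ j, wedgeIncl X j ≫ f = wedgeIncl X j ≫ g) : f = g := by
  refine hom_ext (wedge_cases ?_ fun j x => ?_)
  · rw [f.map_pt, g.map_pt]
  · exact congrArg (fun k : X j ⟶ Z => k.toMap x) (h j)

lemma homotopic_wedge {Z : PtdTop} {f g : wedge X ⟶ Z}
    (h : ∀ j, Homotopic (wedgeIncl X j ≫ f) (wedgeIncl X j ≫ g)) : Homotopic f g := by
  have H := fun j => (h j).some
  have hH : ∀ j t, H j (t, (X j).pt) = Z.pt := fun j t => by
    rw [(H j).eq_fst t rfl]; exact Hom.map_pt (wedgeIncl X j ≫ f)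
  let K : (wedge X).carrier → C(unitInterval, Z.carrier) :=
    wedgeFun (fun j x => ⟨fun t => H j (t, x), by fun_prop⟩) (ContinuousMap.const _ Z.pt)
      (fun j => by ext t; exact hH j t)
  have hK : Continuous K := continuous_wedgeFun _ _ _ fun j =>
    ContinuousMap.continuous_of_continuous_uncurry _
      ((H j).continuous.comp (continuous_snd.prodMk continuous_fst))
  refine Homotopic.mk (fun t x => K x t) ?_ ?_ ?_ ?_
  · exact (continuous_eval.comp ((hK.comp continuous_snd).prodMk continuous_fst))
  · refine wedge_cases ?_ fun j x => ?_
    · rw [f.map_pt]; rfl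
    · exact (H j).map_zero_left x
  · refine wedge_cases ?_ fun j x => ?_
    · rw [g.map_pt]; rfl
    · exact (H j).map_one_left x
  · intro t; rfl

end PtdTop

open Metric in
/-- A map from the `k`-sphere to a Euclidean space of dimension at least `k + 2` can be
approximated by maps which avoid a given line. -/
lemma exists_approx_avoiding_line {k m : ℕ} (hkm : k + 1 < m) (b : EuclideanSpace ℝ (Fin m))
    (F : C(sphere (0 : EuclideanSpace ℝ (Fin (k + 1))) 1, EuclideanSpace ℝ (Fin m)))
    {ε : ℝ} (hε : 0 < ε) :
    ∃ G : C(sphere (0 : EuclideanSpace ℝ (Fin (k + 1))) 1, EuclideanSpace ℝ (Fin m)),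
      ∀ x, dist (G x) (F x) < ε ∧ ∀ s : ℝ, G x ≠ s • b := by
  obtain ⟨F', hF'⟩ := F.exists_restrict_eq isClosed_sphere
  obtain ⟨P, hP, hPF, -⟩ := F'.continuous.exists_contDiff_approx 1
    (continuous_const (y := ε / 2)) (fun _ => by positivity)
  let v : EuclideanSpace ℝ (Fin (k + 1)) := EuclideanSpace.single 0 1
  have hv : ‖v‖ = 1 := by simp [v]
  have : Fact (Module.finrank ℝ (EuclideanSpace ℝ (Fin (k + 1))) = k + 1) := ⟨by simp⟩
  have hfr : Module.finrank ℝ (ℝ ∙ v)ᗮ = k :=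
    Submodule.finrank_orthogonal_span_singleton (by intro h; simp [h] at hv)
  let Q : (ℝ ∙ v)ᗮ × ℝ → EuclideanSpace ℝ (Fin m) :=
    fun p => P (stereoInvFunAux v (p.1 : EuclideanSpace ℝ (Fin (k + 1)))) + p.2 • b
  have hQ : ContDiff ℝ 1 Q := by
    refine ContDiff.add ?_ (contDiff_snd.smul contDiff_const)
    exact hP.comp (contDiff_stereoInvFunAux.comp
      ((ℝ ∙ v)ᗮ.subtypeL.contDiff.comp contDiff_fst))
  let R : ℝ → EuclideanSpace ℝ (Fin m) := fun s => P v + s • b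
  have hR : ContDiff ℝ 1 R := contDiff_const.add (contDiff_id.smul contDiff_const)
  have hdim : dimH (Set.range Q ∪ Set.range R) <
      Module.finrank ℝ (EuclideanSpace ℝ (Fin m)) := by
    rw [dimH_union, max_lt_iff]
    refine ⟨hQ.dimH_range_le.trans_lt ?_, hR.dimH_range_le.trans_lt ?_⟩
    · rw [Module.finrank_prod, hfr, Module.finrank_self, finrank_euclideanSpace_fin]
      exact_mod_cast hkm
    · rw [Module.finrank_self, finrank_euclideanSpace_fin]
      exact_mod_cast (by omega : 1 < m)
  obtain ⟨w, hw, hwε⟩ := (dense_compl_of_dimH_lt_finrank hdim).exists_dist_lt 0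
    (half_pos hε)
  refine ⟨⟨fun x => P x - w, (hP.continuous.comp continuous_subtype_val).sub continuous_const⟩,
    fun x => ⟨?_, fun s hs => hw ?_⟩⟩
  · have h1 := hPF x
    have h2 : F' x = F x := congrArg (fun g : C(_, _) => g x) hF'
    rw [h2] at h1
    rw [dist_eq_norm] at h1 hwε ⊢
    have : (P x - w) - F x = (P x - F x) + (0 - w) := by abel
    calc ‖(P x - w) - F x‖ = ‖(P x - F x) + (0 - w)‖ := by rw [this]
      _ ≤ ‖P x - F x‖ + ‖0 - w‖ := norm_add_le _ _
      _ < ε := by linarith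
  · have hs' : P x - w = s • b := hs
    have hwx : w = P x + (-s) • b := by rw [neg_smul, ← hs']; abel
    by_cases hx : (x : EuclideanSpace ℝ (Fin (k + 1))) = v
    · exact Or.inr ⟨-s, by simp only [R]; rw [← hx, hwx]⟩
    · refine Or.inl ⟨(stereoToFun v x, -s), ?_⟩
      have h3 : stereoInvFunAux v (stereoToFun v x : EuclideanSpace ℝ (Fin (k + 1))) = x :=
        congrArg Subtype.val (stereo_left_inv hv hx)
      simp only [Q]
      rw [hwx, h3]

open scoped unitInterval RealInnerProductSpace in
/-- A map into the unit sphere which is close to a map avoiding a line through the unit vector `b`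
can be deformed into the constant map `b`, without moving the points that are mapped to `b`. -/
lemma exists_deformation {X V : Type*} [TopologicalSpace X] [NormedAddCommGroup V]
    [InnerProductSpace ℝ V] {b : V} (hb : ‖b‖ = 1) (F G : C(X, V)) (hF : ∀ x, ‖F x‖ = 1)
    (hG : ∀ x, dist (G x) (F x) < 1 / 4 ∧ ∀ s : ℝ, G x ≠ s • b) :
    ∃ y : I × X → V, Continuous y ∧ (∀ p, ‖y p‖ = 1) ∧ (∀ x, y (0, x) = F x) ∧
      (∀ x, y (1, x) = b) ∧ ∀ t x, F x = b → y (t, x) = b := by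
  let s : I → ℝ := fun t => min 1 (3 * t)
  let r : I → ℝ := fun t => max 0 (min 1 (3 * t - 1))
  let q : I → ℝ := fun t => max 0 (3 * t - 2)
  let v : I × X → V := fun p => F p.2 + r p.1 • (G p.2 - F p.2)
  let c : V → ℝ := fun w => min 1 (‖w‖ + ⟪w, b⟫)
  let u : I × X → ℝ := fun p => q p.1 + (1 - q p.1) * (s p.1 * c (v p))
  let z : I × X → V := fun p => (1 - u p) • v p + u p • b
  have hr : ∀ t, 0 ≤ r t ∧ r t ≤ 1 := fun t =>
    ⟨le_max_left _ _, max_le zero_le_one (min_le_left _ _)⟩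
  have hq : ∀ t, 0 ≤ q t ∧ q t ≤ 1 := fun t =>
    ⟨le_max_left _ _, max_le zero_le_one (by have := t.2.2; linarith)⟩
  have hvF : ∀ p, ‖v p - F p.2‖ < 1 / 4 := by
    intro p
    have h := (hG p.2).1
    rw [dist_eq_norm] at h
    simp only [v, add_sub_cancel_left, norm_smul, Real.norm_eq_abs, abs_of_nonneg (hr p.1).1]
    nlinarith [hr p.1, norm_nonneg (G p.2 - F p.2)]
  have hv0 : ∀ p, v p ≠ 0 := by
    intro p h
    have := hvF p
    rw [h, zero_sub, norm_neg, hF] at this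
    norm_num at this
  have hz : ∀ p, z p ≠ 0 := by
    intro p h
    have hu1 : 1 - u p ≠ 0 := by
      intro hu
      have hu' : u p = 1 := by linarith
      simp only [z, hu'] at h
      simp only [sub_self, zero_smul, one_smul, zero_add] at h
      simp [h] at hb
    have hvb : v p = (-(u p / (1 - u p))) • b := by
      have h2 : (1 - u p) • v p = -(u p • b) := eq_neg_of_add_eq_zero_left h
      rw [← inv_smul_smul₀ hu1 (v p), h2, smul_neg, smul_smul, neg_smul]
      congr 2
      field_simp
    by_cases hqt : q p.1 = 0
    · set a := -(u p / (1 - u p)) with ha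
      have hc : c (v p) = min 1 (|a| + a) := by
        simp only [c]
        rw [hvb, norm_smul, hb, real_inner_smul_left, real_inner_self_eq_norm_sq, hb]
        simp
      have hu0 : u p = s p.1 * c (v p) := by simp only [u, hqt]; ring
      have hs : 0 ≤ s p.1 ∧ s p.1 ≤ 1 :=
        ⟨le_min zero_le_one (by have := p.1.2.1; linarith), min_le_left _ _⟩
      have hc01 : 0 ≤ c (v p) ∧ c (v p) ≤ 1 := by
        rw [hc]
        exact ⟨le_min zero_le_one (by linarith [neg_abs_le a]), min_le_left _ _⟩
      have hu01 : 0 ≤ u p ∧ u p ≤ 1 := by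
        rw [hu0]
        exact ⟨mul_nonneg hs.1 hc01.1, by nlinarith⟩
      have ha0 : a ≤ 0 := by
        rw [ha, neg_nonpos]
        exact div_nonneg hu01.1 (by linarith)
      have hc0 : c (v p) = 0 := by
        rw [hc, abs_of_nonpos ha0]; simp
      have : u p = 0 := by rw [hu0, hc0, mul_zero]
      apply hv0 p
      rw [hvb, ha, this]
      simp
    · have ht : (2 : ℝ) < 3 * p.1 := by
        by_contra hcon
        exact hqt (max_eq_left (by linarith))
      have hr1 : r p.1 = 1 := by
        simp only [r]
        rw [min_eq_left (by linarith), max_eq_right zero_le_one]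
      refine (hG p.2).2 (-(u p / (1 - u p))) ?_
      rw [← hvb]
      simp [v, hr1]
  have hcont : Continuous z := by
    have h1 : Continuous s := by fun_prop
    have h2 : Continuous r := by fun_prop
    have h3 : Continuous q := by fun_prop
    have h4 : Continuous v := by fun_prop
    have h5 : Continuous c := by fun_prop
    have h6 : Continuous u := by fun_prop
    fun_prop
  refine ⟨fun p => ‖z p‖⁻¹ • z p, ?_, ?_, ?_, ?_, ?_⟩
  · exact (hcont.norm.inv₀ fun p => norm_ne_zero_iff.2 (hz p)).smul hcont
  · intro p
    rw [norm_smul, norm_inv, norm_norm, inv_mul_cancel₀ (norm_ne_zero_iff.2 (hz p))]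
  · intro x
    have : z (0, x) = F x := by simp [z, u, v, q, s, r]
    simp only [this, hF]; simp
  · intro x
    have : z (1, x) = b := by
      have : q 1 = 1 := by simp only [q]; norm_num
      simp [z, u, this]
    simp only [this, hb]; simp
  · intro t x hx
    have : z (t, x) = b := by
      by_cases ht : (3 : ℝ) * t ≤ 1
      · have hr0 : r t = 0 := by
          simp only [r]
          exact max_eq_left ((min_le_right _ _).trans (by linarith))
        have : v (t, x) = b := by simp [v, hr0, hx]
        simp only [z, this, ← add_smul]
        simp
      · have hs1 : s t = 1 := min_eq_left (by linarith)
        have h1 := hvF (t, x)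
        simp only [hx] at h1
        have h2 : 1 ≤ ‖v (t, x)‖ + ⟪v (t, x), b⟫ := by
          have h3 : ‖b‖ ≤ ‖v (t, x)‖ + ‖v (t, x) - b‖ := norm_le_norm_add_norm_sub _ _
          have h4 : ⟪v (t, x), b⟫ = 1 + ⟪v (t, x) - b, b⟫ := by
            rw [inner_sub_left, real_inner_self_eq_norm_sq, hb]; ring
          have h5 := neg_le_of_abs_le (abs_real_inner_le_norm (v (t, x) - b) b)
          rw [hb] at h3 h5
          linarith
        have hc1 : c (v (t, x)) = 1 := min_eq_left h2
        have hu1 : u (t, x) = 1 := by simp only [u, hs1, hc1]; ring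
        simp [z, hu1]
    simp only [this, hb]; simp

namespace PtdTop

open scoped unitInterval in
/-- Every pointed map from `S^k` to a finite wedge of spheres of dimensions greater than `k` is
pointed homotopic to the constant map. -/
theorem homotopic_const_of_lt {J : Type} [Finite J] {k : ℕ} (d : J → ℕ) (hd : ∀ j, k < d j)
    (f : sphere k ⟶ wedge fun j => sphere (d j)) : Homotopic f (const _ _) := by
  classical
  let S : J → PtdTop := fun j => sphere (d j)
  have : ∀ j, CompactSpace (S j).carrier := fun j =>
    isCompact_iff_compactSpace.1 (isCompact_sphere _ _)
  have : ∀ j, T2Space (S j).carrier := fun j =>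
    inferInstanceAs (T2Space (Metric.sphere (0 : EuclideanSpace ℝ (Fin (d j + 1))) 1))
  have : CompactSpace (wedge S).carrier :=
    inferInstanceAs (CompactSpace (Quot (WedgeRel S)))
  -- the coordinates of a point of the wedge
  let pr : ∀ i, wedge S ⟶ S i := fun i =>
    wedgeDesc fun j => if h : j = i then eqToHom (by rw [h]) else const _ _
  have pr_self : ∀ i x, (pr i).toMap ((wedgeIncl S i).toMap x) = x := by
    intro i x
    change Hom.toMap (wedgeIncl S i ≫ pr i) x = x
    rw [wedgeIncl_desc, dif_pos rfl]; rfl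
  have pr_ne : ∀ i j x, j ≠ i → (pr i).toMap ((wedgeIncl S j).toMap x) = (S i).pt := by
    intro i j x h
    change Hom.toMap (wedgeIncl S j ≫ pr i) x = _
    rw [wedgeIncl_desc, dif_neg h]; rfl
  let e : (wedge S).carrier → ∀ j, (S j).carrier := fun x j => (pr j).toMap x
  have he : Continuous e := continuous_pi fun j => (pr j).toMap.continuous
  have he0 : e (wedge S).pt = fun j => (S j).pt := funext fun j => (pr j).map_pt
  have he1 : ∀ j x, e ((wedgeIncl S j).toMap x) = Function.update (fun j => (S j).pt) j x := by
    intro j x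
    funext i
    by_cases h : i = j
    · subst h; simp [e, pr_self]
    · rw [Function.update_of_ne h]; exact pr_ne i j x (Ne.symm h)
  have hsurj : ∀ y : ∀ j, (S j).carrier, (∀ i j, i ≠ j → y i = (S i).pt ∨ y j = (S j).pt) →
      ∃ x, e x = y := by
    intro y hy
    by_cases h : ∃ j, y j ≠ (S j).pt
    · obtain ⟨j, hj⟩ := h
      refine ⟨(wedgeIncl S j).toMap (y j), ?_⟩
      rw [he1]
      funext i
      by_cases hij : i = j
      · subst hij; simp
      · rw [Function.update_of_ne hij]
        exact ((hy i j hij).resolve_right hj).symm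
    · push Not at h
      exact ⟨_, he0.trans (funext fun j => (h j).symm)⟩
  have hzero : ∀ x, e x = (fun j => (S j).pt) → x = (wedge S).pt := by
    refine wedge_cases (fun _ => rfl) fun j x h => ?_
    have : x = (S j).pt := by rw [← pr_self j x]; exact congrFun h j
    rw [this, (wedgeIncl S j).map_pt]
  have hinj : Function.Injective e := by
    intro x
    refine wedge_cases (X := S) (p := fun x => ∀ y, e x = e y → x = y) ?_ ?_ x
    · intro y h; exact (hzero y (h.symm.trans he0)).symm
    · intro j a
      refine wedge_cases ?_ ?_
      · intro h; exact hzero _ (h.trans he0)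
      · intro i c h
        by_cases hij : i = j
        · subst hij
          have := congrFun h i
          simp only [e, pr_self] at this
          rw [this]
        · have h1 := congrFun h j
          simp only [e, pr_self] at h1
          rw [pr_ne j i c hij] at h1
          have h2 := congrFun h i
          simp only [e, pr_self] at h2
          rw [pr_ne i j a (Ne.symm hij)] at h2
          rw [h1, ← h2, (wedgeIncl S j).map_pt, (wedgeIncl S i).map_pt]
  have hemb : Topology.IsEmbedding e := (he.isClosedEmbedding hinj).isEmbedding
  -- the coordinates of `f`
  let F : ∀ j, C((sphere k).carrier, EuclideanSpace ℝ (Fin (d j + 1))) := fun j =>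
    ⟨fun x => ((pr j).toMap (f.toMap x)).1,
      continuous_subtype_val.comp ((pr j).toMap.continuous.comp f.toMap.continuous)⟩
  have hb : ∀ j, ‖((S j).pt).1‖ = 1 := fun j => mem_sphere_zero_iff_norm.1 (S j).pt.2
  have hF : ∀ j x, ‖F j x‖ = 1 := fun j x =>
    mem_sphere_zero_iff_norm.1 ((pr j).toMap (f.toMap x)).2
  choose G hG using fun j => exists_approx_avoiding_line (Nat.add_lt_add_right (hd j) 1)
    ((S j).pt).1 (F j) (by norm_num : (0 : ℝ) < 1 / 4)
  choose y hyc hy1 hy0 hyb hypt using fun j => exists_deformation (hb j) (F j) (G j) (hF j) (hG j)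
  let Y : I × (sphere k).carrier → ∀ j, (S j).carrier := fun p j =>
    ⟨y j p, mem_sphere_zero_iff_norm.2 (hy1 j p)⟩
  have hY : Continuous Y := continuous_pi fun j => (hyc j).subtype_mk _
  have hYone : ∀ p i j, i ≠ j → Y p i = (S i).pt ∨ Y p j = (S j).pt := by
    rintro ⟨t, x⟩ i j hij
    have : e (f.toMap x) i = (S i).pt ∨ e (f.toMap x) j = (S j).pt := by
      refine wedge_cases (X := S) (p := fun w => e w i = (S i).pt ∨ e w j = (S j).pt) ?_ ?_ _
      · exact Or.inl (congrFun he0 i)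
      · intro l a
        by_cases hl : l = i
        · subst hl; exact Or.inr (pr_ne j l a hij)
        · exact Or.inl (pr_ne i l a hl)
    refine this.imp (fun h => Subtype.ext (hypt i t x ?_)) (fun h => Subtype.ext (hypt j t x ?_))
    · exact congrArg Subtype.val h
    · exact congrArg Subtype.val h
  choose H hH using fun p => hsurj (Y p) (hYone p)
  refine Homotopic.mk (fun t x => H (t, x)) ?_ ?_ ?_ ?_
  · rw [hemb.continuous_iff]
    have : e ∘ (fun p : I × (sphere k).carrier => H (p.1, p.2)) = Y := funext fun p => hH p
    rw [this]; exact hY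
  · intro x
    apply hinj
    rw [hH]
    funext j
    exact Subtype.ext (hy0 j x)
  · intro x
    change _ = (wedge S).pt
    apply hinj
    rw [hH, he0]
    funext j
    exact Subtype.ext (hyb j x)
  · intro t
    change _ = (wedge S).pt
    apply hinj
    rw [hH, he0]
    funext j
    refine Subtype.ext (hypt j t _ ?_)
    change ((pr j).toMap (f.toMap (sphere k).pt)).1 = _
    rw [f.map_pt]
    exact congrArg Subtype.val (congrFun he0 j)

end PtdTop

/-! ### The category `Π` -/

/-- The sphere `S^i`, `i ≥ 1`, as an object of `Π`. -/
noncomputable def S (i : ℕ+) : SphereCat where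
  obj := (Quotient.functor PtdTop.Homotopic).obj (PtdTop.sphere i)
  property := ⟨Unit, inferInstance, fun _ => i, fun _ => i.2,
    ⟨(Quotient.functor PtdTop.Homotopic).mapIso
      { hom := PtdTop.wedgeIncl (fun _ : Unit => PtdTop.sphere i) ()
        inv := PtdTop.wedgeDesc fun _ => 𝟙 _
        hom_inv_id := PtdTop.wedgeIncl_desc _ _
        inv_hom_id := PtdTop.wedge_hom_ext fun _ => by
          rw [← Category.assoc, PtdTop.wedgeIncl_desc]; simp }⟩⟩

/-- The class of the constant map. -/
def zeroHom (X Y : SphereCat) : X ⟶ Y :=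
  ObjectProperty.homMk ((Quotient.functor PtdTop.Homotopic).map (PtdTop.const X.obj.as Y.obj.as))

lemma exists_rep {X Y : SphereCat} (f : X ⟶ Y) :
    ∃ g : X.obj.as ⟶ Y.obj.as, (Quotient.functor PtdTop.Homotopic).map g = f.hom :=
  (Quotient.functor PtdTop.Homotopic).map_surjective f.hom

@[simp]
lemma zeroHom_comp {X Y Z : SphereCat} (f : Y ⟶ Z) : zeroHom X Y ≫ f = zeroHom X Z := by
  obtain ⟨g, hg⟩ := exists_rep f
  apply ObjectProperty.hom_ext
  change (Quotient.functor PtdTop.Homotopic).map _ ≫ f.hom = (Quotient.functor _).map _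
  rw [← hg, ← Functor.map_comp]
  congr 1
  exact PtdTop.hom_ext fun _ => g.map_pt

@[simp]
lemma comp_zeroHom {X Y Z : SphereCat} (f : X ⟶ Y) : f ≫ zeroHom Y Z = zeroHom X Z := by
  obtain ⟨g, hg⟩ := exists_rep f
  apply ObjectProperty.hom_ext
  change f.hom ≫ (Quotient.functor PtdTop.Homotopic).map _ = (Quotient.functor _).map _
  rw [← hg, ← Functor.map_comp]
  rfl

/-- A finite wedge of spheres as an object of `Π`. -/
noncomputable def wedgeObj {J : Type} [Finite J] (d : J → ℕ+) : SphereCat where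
  obj := (Quotient.functor PtdTop.Homotopic).obj (PtdTop.wedge fun j => PtdTop.sphere (d j))
  property := ⟨J, inferInstance, fun j => d j, fun j => (d j).2, ⟨Iso.refl _⟩⟩

/-- The inclusion of a sphere in a wedge. -/
noncomputable def wedgeObjIncl {J : Type} [Finite J] (d : J → ℕ+) (j : J) : S (d j) ⟶ wedgeObj d :=
  ObjectProperty.homMk ((Quotient.functor PtdTop.Homotopic).map
    (PtdTop.wedgeIncl (fun j => PtdTop.sphere (d j)) j))

/-- Wedges are coproducts in `Π`. -/
lemma nonempty_isColimit_wedgeObj {J : Type} [Finite J] (d : J → ℕ+) :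
    Nonempty (IsColimit (Cofan.mk (wedgeObj d) (wedgeObjIncl d))) := by
  have hex : ∀ (Z : SphereCat) (g : ∀ j, S (d j) ⟶ Z),
      ∃ m : wedgeObj d ⟶ Z, ∀ j, wedgeObjIncl d j ≫ m = g j := by
    intro Z g
    choose h hh using fun j => exists_rep (g j)
    refine ⟨ObjectProperty.homMk ((Quotient.functor PtdTop.Homotopic).map
      (PtdTop.wedgeDesc (X := fun j => PtdTop.sphere (d j)) h)), fun j => ?_⟩
    apply ObjectProperty.hom_ext
    rw [← hh j]
    exact ((Quotient.functor PtdTop.Homotopic).map_comp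
      (PtdTop.wedgeIncl (fun j => PtdTop.sphere (d j)) j) (PtdTop.wedgeDesc h)).symm
  have huniq : ∀ (Z : SphereCat) (m m' : wedgeObj d ⟶ Z),
      (∀ j, wedgeObjIncl d j ≫ m = wedgeObjIncl d j ≫ m') → m = m' := by
    intro Z m m' h
    obtain ⟨f, hf⟩ := exists_rep m
    obtain ⟨f', hf'⟩ := exists_rep m'
    apply ObjectProperty.hom_ext
    rw [← hf, ← hf', Quotient.functor_map_eq_iff]
    refine PtdTop.homotopic_wedge (X := fun j => PtdTop.sphere (d j)) fun j => ?_
    rw [← Quotient.functor_map_eq_iff PtdTop.Homotopic]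
    have := congrArg (fun k : S (d j) ⟶ Z => k.hom) (h j)
    change (Quotient.functor PtdTop.Homotopic).map
      (PtdTop.wedgeIncl (fun j => PtdTop.sphere (d j)) j) ≫ m.hom =
      (Quotient.functor PtdTop.Homotopic).map
        (PtdTop.wedgeIncl (fun j => PtdTop.sphere (d j)) j) ≫ m'.hom at this
    rw [← hf, ← hf'] at this
    exact ((Functor.map_comp _ _ _).trans this).trans (Functor.map_comp _ _ _).symm
  choose m hm using hex
  exact ⟨Cofan.IsColimit.mk _ (fun s => m s.pt s.inj) (fun s j => hm _ _ j)
    fun s t ht => huniq _ _ _ fun j => (ht j).trans (hm _ _ j).symm⟩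

lemma exists_wedge (X : SphereCat) : ∃ (J : Type) (_ : Finite J) (d : J → ℕ+)
    (i : ∀ j, S (d j) ⟶ X), Nonempty (IsColimit (Cofan.mk X i)) := by
  obtain ⟨J, hJ, d, hd, ⟨e⟩⟩ := X.property
  let d' : J → ℕ+ := fun j => ⟨d j, hd j⟩
  let e' : X ≅ wedgeObj d' := ObjectProperty.isoMk _ e
  obtain ⟨h⟩ := nonempty_isColimit_wedgeObj d'
  exact ⟨J, hJ, d', fun j => wedgeObjIncl d' j ≫ e'.inv,
    ⟨IsColimit.ofIsoColimit h (Cofan.ext e'.symm fun j => rfl)⟩⟩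

/-- Maps from a sphere to a wedge of spheres of higher dimensions are trivial. -/
lemma eq_zeroHom_of_lt {J : Type} [Finite J] (d : J → ℕ+) (k : ℕ+) (h : ∀ j, k < d j)
    (f : S k ⟶ wedgeObj d) : f = zeroHom _ _ := by
  obtain ⟨g, hg⟩ := exists_rep f
  apply ObjectProperty.hom_ext
  rw [← hg]
  exact (Quotient.functor_map_eq_iff PtdTop.Homotopic _ _).2
    (PtdTop.homotopic_const_of_lt (fun j => (d j : ℕ)) (fun j => h j) g)

/-! ### `Π`-algebras -/

/-- `Π`-algebras are the functors `Πᵒᵖ ⥤ Set` that preserve finite products, that is, contravariant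
functors on `Π` sending finite wedges to products. -/
def IsPiAlg : ObjectProperty (SphereCatᵒᵖ ⥤ Type u) := fun A => PreservesFiniteProducts A

/-- The category of `Π`-algebras. -/
abbrev PiAlg := IsPiAlg.{u}.FullSubcategory

/-- The underlying graded set of a `Π`-algebra: `A ↦ A(S^i)`. -/
noncomputable def gradedSet (i : ℕ+) : PiAlg.{u} ⥤ Type u :=
  IsPiAlg.ι ⋙ (evaluation _ _).obj (op (S i))

/-- A `Π`-algebra `A` is `n`-connected if `A(S^i)` is a point for all `i ≤ n`. -/
def IsNConnected (n : ℕ) : ObjectProperty PiAlg.{u} := fun A =>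
  ∀ i : ℕ+, (i : ℕ) ≤ n → Nonempty (Unique ((gradedSet i).obj A))

/-- The category of `n`-connected `Π`-algebras. -/
abbrev ConnPiAlg (n : ℕ) := (IsNConnected.{u} n).FullSubcategory

/-- The inclusion of `n`-connected `Π`-algebras in all `Π`-algebras. -/
abbrev incl (n : ℕ) : ConnPiAlg.{u} n ⥤ PiAlg.{u} := (IsNConnected.{u} n).ι

lemma IsPiAlg.ext {A : SphereCatᵒᵖ ⥤ Type u} (hA : IsPiAlg A) {J : Type} [Finite J]
    {X : J → SphereCat} {Y : SphereCat} {i : ∀ j, X j ⟶ Y} (hc : IsColimit (Cofan.mk Y i))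
    {a b : A.obj (op Y)} (h : ∀ j, A.map (i j).op a = A.map (i j).op b) : a = b := by
  have : PreservesFiniteProducts A := hA
  have h1 := isLimitOfPreserves A (Cofan.IsColimit.op hc)
  exact (Types.isLimitEquivSections h1).injective (Subtype.ext (funext fun ⟨j⟩ => h j))

lemma IsPiAlg.map_zeroHom_eq {A : SphereCatᵒᵖ ⥤ Type u} (hA : IsPiAlg A) {X Y Y' : SphereCat}
    (a : A.obj (op Y)) (a' : A.obj (op Y')) :
    A.map (zeroHom X Y).op a = A.map (zeroHom X Y').op a' := by
  obtain ⟨h⟩ := nonempty_isColimit_wedgeObj (fun e : Empty => e.elim)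
  have : A.map (zeroHom (wedgeObj _) Y).op a = A.map (zeroHom _ Y').op a' :=
    hA.ext h fun j => j.elim
  have := congrArg (A.map (zeroHom X (wedgeObj fun e : Empty => e.elim)).op) this
  rw [← Functor.map_comp_apply, ← Functor.map_comp_apply, ← op_comp, ← op_comp] at this
  simpa using this

/-! ### Connected covers -/

/-- The `n`-th connected cover of a `Π`-algebra `A`: the elements of `A(X)` whose restriction along
every map `S^i ⟶ X` with `i ≤ n` is trivial, i.e. equal to the restriction along the constant map.
For a wedge `X` of spheres this is the product of the `A(S^i)` over the spheres of dimension `> n`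
in `X`, in other words the value of `A` at the wedge of these spheres. -/
def connCoverSub (n : ℕ) (A : SphereCatᵒᵖ ⥤ Type u) : Subfunctor A where
  obj X := {a | ∀ i : ℕ+, (i : ℕ) ≤ n → ∀ f : S i ⟶ X.unop,
    A.map f.op a = A.map (zeroHom (S i) X.unop).op a}
  map {X Y} g a ha i hi f := by
    have h1 := ha i hi (f ≫ g.unop)
    have h2 := ha i hi (zeroHom (S i) Y.unop ≫ g.unop)
    rw [op_comp, Functor.map_comp_apply] at h1 h2
    exact h1.trans (by rw [← zeroHom_comp (X := S i) g.unop] at *; exact h2.symm)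

lemma isPiAlg_connCover (n : ℕ) {A : SphereCatᵒᵖ ⥤ Type u} (hA : IsPiAlg A) :
    IsPiAlg (connCoverSub n A).toFunctor := by
  have hA' : PreservesFiniteProducts A := hA
  refine ⟨fun m => ⟨fun {K} => ⟨fun {c} hc => ?_⟩⟩⟩
  have h1 : IsLimit (A.mapCone c) := isLimitOfPreserves A hc
  refine (Types.isLimit_iff _).2 fun s hs => ?_
  obtain ⟨a, ha, hauniq⟩ := (Types.isLimit_iff _).1 ⟨h1⟩ (fun j => (s j).1)
    (fun {i j} f => congrArg Subtype.val (hs f))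
  suffices hC : a ∈ (connCoverSub n A).obj c.pt by
    refine ⟨⟨a, hC⟩, fun j => Subtype.ext (ha j), fun y hy => Subtype.ext ?_⟩
    exact hauniq _ fun j => congrArg Subtype.val (hy j)
  intro k hk f
  -- the summands of the wedge `c.pt`
  let X : Discrete (Fin m) → SphereCat := fun j => (K.obj j).unop
  let inc : ∀ j, X j ⟶ c.pt.unop := fun j => (c.π.app j).unop
  have hdesc : ∀ (Z : SphereCat) (g : ∀ j, X j ⟶ Z), ∃ r : c.pt.unop ⟶ Z,
      ∀ j, inc j ≫ r = g j := by
    intro Z g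
    let t : Cone K :=
      { pt := op Z
        π := { app := fun j => (g j).op
               naturality := by
                rintro j j' φ
                obtain rfl := Discrete.eq_of_hom φ |> Discrete.ext
                obtain rfl : φ = 𝟙 _ := Subsingleton.elim _ _
                simp } }
    exact ⟨(hc.lift t).unop, fun j => Quiver.Hom.op_inj (hc.fac t j)⟩
  have ha' : ∀ j, A.map (inc j).op a = (s j).1 := ha
  choose J hJ d i hi using fun j => exists_wedge (X j)
  let T := Σ j : Discrete (Fin m), {l : J j // k < d j l}
  let dT : T → ℕ+ := fun t => d t.1 t.2.1
  have hdl : ∀ {j : Discrete (Fin m)} {Z : SphereCat} (g : ∀ l, S (d j l) ⟶ Z),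
      ∃ r : X j ⟶ Z, ∀ l, i j l ≫ r = g l := fun {j Z} g =>
    ⟨Cofan.IsColimit.desc (hi j).some g, fun l => Cofan.IsColimit.fac (hi j).some g l⟩
  classical
  choose r hr using fun j => hdl (j := j) (Z := wedgeObj dT) fun l =>
    if h : k < d j l then wedgeObjIncl dT ⟨j, l, h⟩ else zeroHom _ _
  obtain ⟨R, hR⟩ := hdesc _ r
  obtain ⟨σ, hσ⟩ : ∃ σ : wedgeObj dT ⟶ c.pt.unop,
      ∀ t : T, wedgeObjIncl dT t ≫ σ = i t.1 t.2.1 ≫ inc t.1 :=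
    ⟨Cofan.IsColimit.desc (nonempty_isColimit_wedgeObj dT).some _,
      fun t => Cofan.IsColimit.fac (nonempty_isColimit_wedgeObj dT).some _ t⟩
  have key : A.map (R ≫ σ).op a = a := by
    refine (hauniq _ fun j => ?_).trans (hauniq a ha).symm
    change A.map (inc j).op (A.map (R ≫ σ).op a) = (s j).1
    rw [← Functor.map_comp_apply, ← op_comp, ← Category.assoc, hR]
    refine hA.ext (hi j).some fun l => ?_
    rw [← Functor.map_comp_apply, ← op_comp, ← Category.assoc, hr]
    by_cases h : k < d j l
    · rw [dif_pos h, hσ, op_comp, Functor.map_comp_apply]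
      exact congrArg _ (ha' j)
    · rw [dif_neg h, zeroHom_comp]
      have hle : ((d j l : ℕ+) : ℕ) ≤ n := le_trans (not_lt.1 h) hk
      have h2 := (s j).2 (d j l) hle (i j l)
      refine Eq.trans ?_ h2.symm
      exact hA.map_zeroHom_eq _ _
  have hfR : f ≫ R = zeroHom _ _ := eq_zeroHom_of_lt dT k (fun t => t.2.2) _
  calc A.map f.op a = A.map f.op (A.map (R ≫ σ).op a) := by rw [key]
    _ = A.map ((f ≫ R) ≫ σ).op a := by
      rw [← Functor.map_comp_apply, ← op_comp, ← Category.assoc]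
    _ = A.map (zeroHom _ _).op a := by rw [hfR, zeroHom_comp]

/-- The `n`-th connected cover of a `Π`-algebra, as a `Π`-algebra. -/
def connCoverObj (n : ℕ) (A : PiAlg.{u}) : PiAlg.{u} :=
  ⟨(connCoverSub n A.obj).toFunctor, isPiAlg_connCover n A.property⟩

lemma isNConnected_connCoverObj (n : ℕ) (A : PiAlg.{u}) : IsNConnected n (connCoverObj n A) := by
  intro i hi
  obtain ⟨h⟩ := nonempty_isColimit_wedgeObj (fun e : Empty => e.elim)
  have h1 := Cofan.IsColimit.op h
  have hA : PreservesFiniteProducts A.obj := A.property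
  obtain ⟨z, -, -⟩ := (Types.isLimit_iff _).1 ⟨isLimitOfPreserves A.obj h1⟩
    (fun j => j.as.elim) (fun {j} => j.as.elim)
  refine ⟨⟨⟨⟨A.obj.map (zeroHom (S i) (wedgeObj _)).op z, fun k hk f => ?_⟩⟩, fun a => ?_⟩⟩
  · rw [← Functor.map_comp_apply, ← Functor.map_comp_apply, ← op_comp, ← op_comp]
    simp
  · refine Subtype.ext ?_
    have := a.2 i hi (𝟙 _)
    rw [op_id, Functor.map_id_apply] at this
    rw [this]
    exact A.property.map_zeroHom_eq _ _

/-- The `n`-th connected cover functor `C_n`. -/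
def connCover (n : ℕ) : PiAlg.{u} ⥤ ConnPiAlg.{u} n where
  obj A := ⟨connCoverObj n A, isNConnected_connCoverObj n A⟩
  map {A A'} φ := ObjectProperty.homMk (ObjectProperty.homMk
    { app := fun X => ↾fun a => ⟨φ.hom.app X a.1, fun i hi f => by
        rw [← NatTrans.naturality_apply, ← NatTrans.naturality_apply, a.2 i hi f]⟩
      naturality := fun X Y f => by
        refine ConcreteCategory.hom_ext _ _ fun a => Subtype.ext ?_
        exact NatTrans.naturality_apply φ.hom f a.1 })

/-- The inclusion `C_n A ⟶ A`. -/
def connCoverCounit (n : ℕ) (A : PiAlg.{u}) : (incl n).obj ((connCover n).obj A) ⟶ A :=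
  ObjectProperty.homMk (connCoverSub n A.obj).ι

/-- The connected cover functor is right adjoint to the inclusion. -/
def connCoverAdj (n : ℕ) : incl.{u} n ⊣ connCover n :=
  Adjunction.mkOfHomEquiv
    { homEquiv := fun B A =>
        { toFun := fun φ => ObjectProperty.homMk (ObjectProperty.homMk
            { app := fun X => ↾fun b => ⟨φ.hom.app X b, fun i hi f => by
                have : Subsingleton (((incl n).obj B).obj.obj (op (S i))) :=
                  @Unique.instSubsingleton _ (B.property i hi).some
                rw [← NatTrans.naturality_apply, ← NatTrans.naturality_apply]
                exact congrArg _ (Subsingleton.elim _ _)⟩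
              naturality := fun X Y f => by
                refine ConcreteCategory.hom_ext _ _ fun b => Subtype.ext ?_
                exact NatTrans.naturality_apply φ.hom f b })
          invFun := fun φ => (incl n).map φ ≫ connCoverCounit n A
          left_inv := fun φ => rfl
          right_inv := fun φ => rfl }
      homEquiv_naturality_left_symm := fun _ _ => rfl
      homEquiv_naturality_right := fun _ _ => rfl }

/-- `C_n A ⟶ A` is bijective on `A(S^i)` for `i > n`. -/
lemma bijective_connCoverCounit (n : ℕ) (A : PiAlg.{u}) (i : ℕ+) (hi : n < i) :
    Function.Bijective ((gradedSet i).map (connCoverCounit n A)) := by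
  refine ⟨fun a b h => Subtype.ext h, fun a => ⟨⟨a, fun k hk f => ?_⟩, rfl⟩⟩
  let d : Unit → ℕ+ := fun _ => i
  obtain ⟨h⟩ := nonempty_isColimit_wedgeObj d
  have h1 : wedgeObjIncl d () ≫ Cofan.IsColimit.desc h (fun _ => 𝟙 (S i)) = 𝟙 _ :=
    Cofan.IsColimit.fac h _ ()
  have h2 : f ≫ wedgeObjIncl d () = zeroHom _ _ :=
    eq_zeroHom_of_lt d k (fun _ => PNat.coe_lt_coe _ _ |>.1 (lt_of_le_of_lt hk hi)) _
  have h3 : f = zeroHom _ _ := by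
    rw [← Category.comp_id f, ← h1, ← Category.assoc, h2, zeroHom_comp]
  rw [h3]

noncomputable instance (n : ℕ) : Coreflective (incl.{u} n) where
  R := connCover n
  adj := connCoverAdj n

/-! ### Limits of `Π`-algebras -/

instance {K : Type} [SmallCategory K] : (IsPiAlg.{u}).IsClosedUnderLimitsOfShape K where
  limitsOfShape_le := by
    rintro A ⟨⟨F, π, hlim⟩, hF⟩
    refine ⟨fun m => ⟨fun {D} => ⟨fun {c} hc => ?_⟩⟩⟩
    have hpt : ∀ X, IsLimit (((evaluation _ (Type u)).obj X).mapCone (Cone.mk A π)) :=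
      fun X => isLimitOfPreserves _ hlim
    have hFc : ∀ k, IsLimit ((F.obj k).mapCone c) := fun k =>
      have : PreservesFiniteProducts (F.obj k) := hF k
      isLimitOfPreserves _ hc
    have ext : ∀ (X) (a b : A.obj X),
        (∀ k, (π.app k).app X a = (π.app k).app X b) → a = b := fun X a b h =>
      (Types.isLimitEquivSections (hpt X)).injective (Subtype.ext (funext h))
    have nat : ∀ (k) {X Y} (g : X ⟶ Y) (a : A.obj X),
        (π.app k).app Y (A.map g a) = (F.obj k).map g ((π.app k).app X a) :=
      fun k _ _ g a => NatTrans.naturality_apply (π.app k) g a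
    refine (Types.isLimit_iff _).2 fun s hs => ?_
    have hsk : ∀ k, (fun j => (π.app k).app (D.obj j) (s j)) ∈ (D ⋙ F.obj k).sections :=
      fun k i j f => by
        have h1 := nat k (D.map f) (s i)
        have h2 : A.map (D.map f) (s i) = s j := hs f
        rw [h2] at h1
        exact h1.symm
    choose x hx hxu using fun k => (Types.isLimit_iff _).1 ⟨hFc k⟩ _ (hsk k)
    have hxs : ∀ {k l} (f : k ⟶ l), (F.map f).app c.pt (x k) = x l := by
      intro k l f
      refine hxu l _ fun j => ?_
      have h1 := NatTrans.naturality_apply (F.map f) (c.π.app j) (x k)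
      have h2 : (F.obj k).map (c.π.app j) (x k) = (π.app k).app _ (s j) := hx k j
      have h3 : (F.map f).app (D.obj j) ((π.app k).app _ (s j)) = (π.app l).app _ (s j) := by
        have := π.naturality f
        have h4 := congrArg (fun φ => φ.app (D.obj j) (s j)) this
        simpa using h4.symm
      rw [h2, h3] at h1
      exact h1.symm
    obtain ⟨a, ha, hau⟩ := (Types.isLimit_iff _).1 ⟨hpt c.pt⟩ x (fun {k l} f => hxs f)
    refine ⟨a, fun j => ext _ _ _ fun k => ?_, fun b hb => ext _ _ _ fun k => ?_⟩
    · have h1 := nat k (X := c.pt) (c.π.app j) a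
      have h2 : (π.app k).app c.pt a = x k := ha k
      rw [h2] at h1
      exact h1.trans (hx k j)
    · refine (hxu k _ fun j => ?_).trans (ha k).symm
      have h1 := nat k (X := c.pt) (c.π.app j) b
      have h2 : A.map (c.π.app j) b = s j := hb j
      rw [h2] at h1
      exact h1.symm

instance : HasPullbacks PiAlg.{u} :=
  inferInstanceAs (HasLimitsOfShape WalkingCospan IsPiAlg.{u}.FullSubcategory)

instance (n : ℕ) : HasPullbacks (ConnPiAlg.{u} n) := hasLimitsOfShape_of_coreflective (incl n)

/-! ### Quillen cohomology -/

section QuillenCohomology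

universe v w u'

attribute [local instance] Over.cartesianMonoidalCategory Over.braidedCategory

open scoped MonObj Obj

variable {C : Type u'} [Category.{v} C]

/-- Let `U` be the underlying graded set functor of a category `C` of universal algebras. A map of
simplicial objects is an acyclic fibration if it is so at the level of underlying graded sets, that
is, if all the resulting maps of simplicial sets are acyclic Kan fibrations (maps with the right
lifting property with respect to the inclusions `∂Δ[m] ⟶ Δ[m]`). -/
def IsAcyclicFibration {I : Type*} (U : I → C ⥤ Type w) {E F : SimplicialObject C} (p : E ⟶ F) :
    Prop :=
  ∀ i, SSet.modelCategoryQuillen.I.rlp (((SimplicialObject.whiskering C (Type w)).obj (U i)).map p)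

/-- A simplicial object is cofibrant if the map from the initial object has the left lifting
property with respect to all acyclic fibrations. -/
def IsCofibrant {I : Type*} (U : I → C ⥤ Type w) (X : SimplicialObject C) : Prop :=
  ∀ ⦃E F : SimplicialObject C⦄ (p : E ⟶ F), IsAcyclicFibration U p →
    ∀ g : X ⟶ F, ∃ l : X ⟶ E, l ≫ p = g

/-- A cofibrant replacement of `X` in simplicial objects: a cofibrant simplicial object `C_•` with
an acyclic fibration to the constant simplicial object on `X`, given as a simplicial object
over `X`. (For simplicial `Π`-algebras, every weak equivalence to a constant object is an acyclic
fibration, because every homomorphism from a simplicial group to a constant simplicial group is a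
fibration.) -/
structure CofibrantReplacement {I : Type*} (U : I → C ⥤ Type w) (X : C) where
  /-- the simplicial object `C_•` over `X` -/
  res : SimplicialObject (Over X)
  isCofibrant : IsCofibrant U (((SimplicialObject.whiskering _ _).obj (Over.forget X)).obj res)
  isAcyclicFibration : IsAcyclicFibration U
    (E := ((SimplicialObject.whiskering _ _).obj (Over.forget X)).obj res)
    (F := (SimplicialObject.const C).obj X)
    { app := fun k => (res.obj k).hom
      naturality := fun _ _ f => (Over.w (res.map f)).trans (Category.comp_id _).symm }

variable [HasPullbacks C]

/-- Beck modules over `X`: abelian group objects in the slice category over `X`. -/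
abbrev BeckModule (X : C) := CommGrp (Over X)

/-- The functor of derivations over `X` into a module `M`, `Y ↦ Hom_{C/X}(Y, M)`, with values in
abelian groups (written additively). -/
noncomputable def derivations {X : C} (M : BeckModule X) : (Over X)ᵒᵖ ⥤ AddCommGrpCat.{v} where
  obj Y := AddCommGrpCat.of (Additive (Y.unop ⟶ M.X))
  map f := AddCommGrpCat.ofHom (MonoidHom.toAdditive
    { toFun := fun g => f.unop ≫ g
      map_one' := MonObj.comp_one _
      map_mul' := fun _ _ => MonObj.comp_mul _ _ _ })
  map_id Y := by
    refine ConcreteCategory.hom_ext _ _ fun g => ?_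
    exact congrArg Additive.ofMul (Category.id_comp g.toMul)
  map_comp f g := by
    refine ConcreteCategory.hom_ext _ _ fun h => ?_
    exact congrArg Additive.ofMul (Category.assoc g.unop f.unop h.toMul)

/-- The cochain complex associated with the cosimplicial abelian group of derivations
`Hom_{C/X}(C_•, M)`. -/
noncomputable def derivationComplex {X : C} (M : BeckModule X) (R : SimplicialObject (Over X)) :
    CochainComplex AddCommGrpCat.{v} ℕ :=
  (AlgebraicTopology.alternatingCofaceMapComplex AddCommGrpCat.{v}).obj (R.rightOp ⋙ derivations M)

/-- Quillen cohomology `HQ^k(X; M) = π^k Hom_{C/X}(C_•, M)`, computed from a cofibrant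
replacement `C_•` of `X`. -/
noncomputable def HQ {I : Type*} {U : I → C ⥤ Type w} {X : C} (P : CofibrantReplacement U X)
    (M : BeckModule X) (k : ℕ) : AddCommGrpCat.{v} :=
  (derivationComplex M P.res).homology k

end QuillenCohomology

/-! ### The comparison map -/

section Comparison

attribute [local instance] Over.cartesianMonoidalCategory Over.braidedCategory

open scoped MonObj Obj

/-- The functor `C_n` on slice categories: `E ⟶ ιB` is sent to the pullback of `C_n E ⟶ C_n ιB`
along the unit `B ⟶ C_n ιB`. -/
noncomputable def connCoverOver (n : ℕ) (B : ConnPiAlg.{u} n) :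
    Over ((incl n).obj B) ⥤ Over B :=
  Over.post (connCover n) ⋙ Over.pullback ((connCoverAdj n).unit.app B)

/-- The adjunction between slice categories induced by the adjunction between the inclusion and
`C_n`. -/
noncomputable def connCoverOverAdj (n : ℕ) (B : ConnPiAlg.{u} n) :
    Over.post (incl n) ⊣ connCoverOver n B :=
  Over.postAdjunctionLeft (connCoverAdj n)

instance (n : ℕ) (B : ConnPiAlg.{u} n) : PreservesFiniteProducts (connCoverOver n B) :=
  have := (connCoverOverAdj n B).rightAdjoint_preservesLimits
  ⟨fun _ => inferInstance⟩

noncomputable instance (n : ℕ) (B : ConnPiAlg.{u} n) : (connCoverOver n B).Braided :=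
  .ofChosenFiniteProducts _

/-- The `B`-module `C_n M` associated with a module `M` over `ιB`. -/
noncomputable def connCoverModule (n : ℕ) {B : ConnPiAlg.{u} n}
    (M : BeckModule ((incl n).obj B)) : BeckModule B :=
  (connCoverOver n B).mapCommGrp.obj M

/-- The natural map `Hom_{/ιB}(ιY, M) ⟶ Hom_{/B}(Y, C_n M)` given by the adjunction. -/
noncomputable def derivationsComparison (n : ℕ) {B : ConnPiAlg.{u} n}
    (M : BeckModule ((incl n).obj B)) :
    (Over.post (incl n)).op ⋙ derivations M ⟶ derivations (connCoverModule n M) where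
  app Y := AddCommGrpCat.ofHom (MonoidHom.toAdditive
    { toFun := (connCoverOverAdj n B).homEquiv Y.unop M.X
      map_one' := by
        rw [Adjunction.homEquiv_unit]
        exact (congrArg _ (Functor.map_one (connCoverOver n B))).trans (MonObj.comp_one _)
      map_mul' := fun f g => by
        rw [Adjunction.homEquiv_unit, Adjunction.homEquiv_unit, Adjunction.homEquiv_unit]
        exact (congrArg _ (Functor.map_mul (connCoverOver n B) f g)).trans
          (MonObj.comp_mul _ _ _) })
  naturality Y Z f := by
    refine ConcreteCategory.hom_ext _ _ fun g => ?_
    exact congrArg Additive.ofMul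
      ((connCoverOverAdj n B).homEquiv_naturality_left f.unop g.toMul)

/-- The maps `ιQ ⟶ P` of simplicial objects over `ιB`, for simplicial objects `P` over `ιB` and `Q`
over `B`. -/
abbrev MapsOver (n : ℕ) {B : ConnPiAlg.{u} n} (Q : SimplicialObject (Over B))
    (P : SimplicialObject (Over ((incl n).obj B))) :=
  ((SimplicialObject.whiskering _ _).obj (Over.post (incl n))).obj Q ⟶ P

/-- Let `P` and `Q` be simplicial objects over `ιB` and `B`. A map `ιQ ⟶ P` over `ιB` induces the
map of cochain complexes `Hom_{/ιB}(P, M) ⟶ Hom_{/ιB}(ιQ, M) ⟶ Hom_{/B}(Q, C_n M)`. -/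
noncomputable def comparisonComplex (n : ℕ) {B : ConnPiAlg.{u} n}
    (M : BeckModule ((incl n).obj B)) {P : SimplicialObject (Over ((incl n).obj B))}
    {Q : SimplicialObject (Over B)}
    (ψ : MapsOver n Q P) :
    derivationComplex M P ⟶ derivationComplex (connCoverModule n M) Q :=
  (AlgebraicTopology.alternatingCofaceMapComplex AddCommGrpCat).map
    (Functor.whiskerRight (NatTrans.rightOp ψ) (derivations M) ≫
      Functor.whiskerLeft Q.rightOp (derivationsComparison n M))

/-- The underlying graded set of an `n`-connected `Π`-algebra. -/
noncomputable def connGradedSet (n : ℕ) (i : ℕ+) : ConnPiAlg.{u} n ⥤ Type u :=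
  incl n ⋙ gradedSet i

/-- The comparison map `HQ^k(ιB; M) ⟶ HQ^k(B; C_n M)` in Quillen cohomology, computed from cofibrant
replacements `P` of `ιB` and `Q` of `B` and a map `ψ : ιQ ⟶ P` over `ιB`. -/
noncomputable def comparison (n : ℕ) {B : ConnPiAlg.{u} n}
    (M : BeckModule ((incl n).obj B)) (P : CofibrantReplacement gradedSet ((incl n).obj B))
    (Q : CofibrantReplacement (connGradedSet n) B)
    (ψ : MapsOver n Q.res P.res) (k : ℕ) :
    HQ P M k ⟶ HQ Q (connCoverModule n M) k :=
  HomologicalComplex.homologyMap (comparisonComplex n M ψ) k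

end Comparison
end PiAlgebra

/-! The inclusion `ι` has the right adjoint `C_n`, and `C_n` preserves acyclic fibrations: on `S^i`
it changes nothing for `i > n` and gives a point for `i ≤ n` (`isAcyclicFibration_connCover`). By
adjunction `ι` preserves cofibrant objects (`isCofibrant_incl`). It also leaves underlying graded
sets unchanged, so `ιQ` is itself a cofibrant replacement of `ιB` (`CofibrantReplacement.incl`). The
comparison map thus factors (`comparison_eq`) as the map induced by `ψ` between two cofibrant
replacements of the same object, followed by the adjunction isomorphism `Hom(ιQ, M) ≅ Hom(Q, C_n M)`
of cochain complexes.

What remains is that maps from a cofibrant object over `A` to a cofibrant replacement of `A` exist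
and are unique up to simplicial homotopy over `A` (`nonempty_hom`, `nonempty_homotopy`), and that
derivations turn such homotopies into cochain homotopies (`cochainHomotopy`). Uniqueness uses the
path object `Y^Δ[1]`, formed separately at each object of `Π`: if `Y ⟶ A` is an acyclic fibration to
a constant object, so is `Y^Δ[1] ⟶ Y ×_A Y` (`SSet.rlp_path`), and a lift of `(f, g)` through it is
a homotopy from `f` to `g` (`exists_path`). This homotopy is automatically over `A`, since
homotopies into a constant simplicial set are constant. -/

/-! ### Homotopies and paths of simplicial sets over a constant base -/

open MonoidalCategory MonoidalClosed Simplicial in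
/-- A homotopy with values in a constant simplicial set is constant. -/
lemma SSet.homotopy_const_apply_eq {X : SSet.{u}} {A : Type u}
    (Φ : X ⊗ Δ[1] ⟶ (SimplicialObject.const (Type u)).obj A) (k : SimplexCategoryᵒᵖ)
    (x : X.obj k) (s s' : Δ[1].obj k) : Φ.app k (x, s) = Φ.app k (x, s') := by
  have hΦ : ∀ {k l : SimplexCategoryᵒᵖ} (f : k ⟶ l) (y : (X ⊗ Δ[1]).obj k),
      Φ.app l ((X ⊗ Δ[1]).map f y) = Φ.app k y := fun f y => NatTrans.naturality_apply Φ f y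
  let v : k ⟶ op ⦋0⦌ := (SimplexCategory.const ⦋0⦌ k.unop 0).op
  -- In the target all structure maps are identities, so `Φ` does not change under faces and
  -- degeneracies. The zeroth vertex of `(x, s)` is an end of one edge that does not depend on `s`:
  -- the degenerate edge at the zeroth vertex of `x`, paired with the generating edge of `Δ[1]`.
  have h : ∀ s : Δ[1].obj k, Φ.app k (x, s) =
      Φ.app (op ⦋1⦌) (X.map (SimplexCategory.const ⦋1⦌ ⦋0⦌ 0).op (X.map v x),
        SSet.stdSimplex.objEquiv.symm (𝟙 _)) := by
    intro s
    let e : op ⦋1⦌ ⟶ op ⦋0⦌ := (SSet.stdSimplex.objEquiv (Δ[1].map v s)).op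
    refine (hΦ v (x, s)).symm.trans (Eq.trans (congrArg (Φ.app (op ⦋0⦌)) ?_) (hΦ e _))
    refine Prod.ext ?_ ?_
    · change X.map v x = X.map e (X.map _ (X.map v x))
      rw [← Functor.map_comp_apply]
      have : (SimplexCategory.const ⦋1⦌ ⦋0⦌ 0).op ≫ e = 𝟙 _ :=
        Quiver.Hom.unop_inj (Subsingleton.elim _ _)
      rw [this, Functor.map_id_apply]
    · change Δ[1].map v s = Δ[1].map e (SSet.stdSimplex.objEquiv.symm (𝟙 _))
      apply SSet.stdSimplex.objEquiv.injective
      rfl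
  rw [h s, h s']

namespace SSet

open MonoidalCategory MonoidalClosed Simplicial

variable {L Y : SSet.{u}} (S : L.Subcomplex)

/-- The subcomplex of the cylinder on `L` consisting of the two ends and of the cylinder on `S`. -/
def cylinderSubcomplex : (L ⊗ Δ[1]).Subcomplex where
  obj k := {z | z.1 ∈ S.obj k ∨ (∃ x, z = ι₀.app k x) ∨ ∃ x, z = ι₁.app k x}
  map {k l} f z hz := by
    rcases hz with hz | ⟨x, rfl⟩ | ⟨x, rfl⟩
    · exact Or.inl (S.map f hz)
    · exact Or.inr (Or.inl ⟨L.map f x, (NatTrans.naturality_apply ι₀ f x).symm⟩)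
    · exact Or.inr (Or.inr ⟨L.map f x, (NatTrans.naturality_apply ι₁ f x).symm⟩)

/-- Every simplex has a zeroth vertex, and its `Δ[1]`-coordinate tells the two ends apart. -/
lemma ι₀_app_ne_ι₁_app (k : SimplexCategoryᵒᵖ) (x y : L.obj k) :
    (ι₀ (X := L)).app k x ≠ (ι₁ (X := L)).app k y := by
  intro h
  obtain ⟨k⟩ := k
  have h1 : (0 : Fin 2) = 1 := congrArg (fun z : (L ⊗ Δ[1]).obj (op k) =>
    (stdSimplex.objEquiv z.2).toOrderHom 0) h
  exact absurd h1 (by decide)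

open Classical in
/-- A map on the ends and on the part over `S` of a cylinder. -/
lemma exists_hom_cylinderSubcomplex (a : (S : SSet.{u}) ⊗ Δ[1] ⟶ Y) (b₀ b₁ : L ⟶ Y)
    (h₀ : ι₀ ≫ a = S.ι ≫ b₀) (h₁ : ι₁ ≫ a = S.ι ≫ b₁) :
    ∃ t : (cylinderSubcomplex S : SSet.{u}) ⟶ Y,
      (∀ k (z : (L ⊗ Δ[1]).obj k) (hz : z.1 ∈ S.obj k),
        t.app k ⟨z, Or.inl hz⟩ = a.app k (⟨z.1, hz⟩, z.2)) ∧
      (∀ k (x : L.obj k), t.app k ⟨ι₀.app k x, Or.inr (Or.inl ⟨x, rfl⟩)⟩ = b₀.app k x) ∧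
      (∀ k (x : L.obj k), t.app k ⟨ι₁.app k x, Or.inr (Or.inr ⟨x, rfl⟩)⟩ = b₁.app k x) := by
  -- The two ends are disjoint, so the pieces overlap only over `S`, where `h₀` and `h₁` give
  -- agreement. Once `T` is known on each piece, naturality can be checked piece by piece.
  let T : ∀ k, (cylinderSubcomplex S).obj k → Y.obj k := fun k z =>
    if h : z.1.1 ∈ S.obj k then a.app k (⟨z.1.1, h⟩, z.1.2)
    else if z.1 = ι₀.app k z.1.1 then b₀.app k z.1.1 else b₁.app k z.1.1
  have hS : ∀ k (z : (L ⊗ Δ[1]).obj k) (hz : z.1 ∈ S.obj k),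
      T k ⟨z, Or.inl hz⟩ = a.app k (⟨z.1, hz⟩, z.2) := fun k z hz => dif_pos hz
  have hT₀ : ∀ k (x : L.obj k), T k ⟨ι₀.app k x, Or.inr (Or.inl ⟨x, rfl⟩)⟩ = b₀.app k x := by
    intro k x
    by_cases hx : x ∈ S.obj k
    · refine (hS k _ hx).trans ?_
      exact ConcreteCategory.congr_hom (NatTrans.congr_app h₀ k) (⟨x, hx⟩ : S.obj k)
    · exact (dif_neg hx).trans (if_pos rfl)
  have hT₁ : ∀ k (x : L.obj k), T k ⟨ι₁.app k x, Or.inr (Or.inr ⟨x, rfl⟩)⟩ = b₁.app k x := by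
    intro k x
    by_cases hx : x ∈ S.obj k
    · refine (hS k _ hx).trans ?_
      exact ConcreteCategory.congr_hom (NatTrans.congr_app h₁ k) (⟨x, hx⟩ : S.obj k)
    · exact (dif_neg hx).trans (if_neg (ι₀_app_ne_ι₁_app k _ _).symm)
  refine ⟨{ app := fun k => ↾(T k), naturality := fun k l f => ?_ }, hS, hT₀, hT₁⟩
  refine ConcreteCategory.hom_ext _ _ fun z => ?_
  change T l (((cylinderSubcomplex S).toFunctor).map f z) = Y.map f (T k z)
  obtain ⟨z, hz | ⟨x, rfl⟩ | ⟨x, rfl⟩⟩ := z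
  · rw [hS k z hz]
    exact (hS l ((L ⊗ Δ[1]).map f z) (S.map f hz)).trans
      (NatTrans.naturality_apply a f ((⟨z.1, hz⟩, z.2) : ((S : SSet.{u}) ⊗ Δ[1]).obj k))
  · rw [hT₀, ← NatTrans.naturality_apply]
    exact hT₀ l _
  · rw [hT₁, ← NatTrans.naturality_apply]
    exact hT₁ l _

/-- Extension of homotopies along a trivial fibration over a constant simplicial set. -/
lemma exists_homotopy_extension {A : Type u} {p : Y ⟶ (SimplicialObject.const (Type u)).obj A}
    (hp : modelCategoryQuillen.I.rlp p)
    (a : (S : SSet.{u}) ⊗ Δ[1] ⟶ Y) (b₀ b₁ : L ⟶ Y)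
    (h₀ : ι₀ ≫ a = S.ι ≫ b₀) (h₁ : ι₁ ≫ a = S.ι ≫ b₁) (hb : b₀ ≫ p = b₁ ≫ p) :
    ∃ H : L ⊗ Δ[1] ⟶ Y, S.ι ▷ Δ[1] ≫ H = a ∧ ι₀ ≫ H = b₀ ∧ ι₁ ≫ H = b₁ := by
  obtain ⟨t, ht, ht₀, ht₁⟩ := exists_hom_cylinderSubcomplex S a b₀ b₁ h₀ h₁
  -- Lifting against boundary inclusions implies lifting against all monomorphisms, in particular
  -- against the inclusion of the subcomplex of the cylinder.
  rw [← rlp_monomorphisms] at hp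
  have hlift := hp (cylinderSubcomplex S).ι
    (inferInstanceAs (Mono (cylinderSubcomplex S).ι))
  have hb' : ∀ k (x : L.obj k), p.app k (b₀.app k x) = p.app k (b₁.app k x) := fun k x =>
    ConcreteCategory.congr_hom (NatTrans.congr_app hb k) x
  -- The desired homotopy must be constant after `p`, so the bottom map forgets the
  -- `Δ[1]`-coordinate. The square commutes over `S` because `a ≫ p` is a homotopy into a constant
  -- simplicial set, and on the second end by `hb`.
  have sq : CommSq t (cylinderSubcomplex S).ι p
      (CartesianMonoidalCategory.fst L Δ[1] ≫ b₀ ≫ p) := by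
    refine ⟨?_⟩
    ext k z
    change p.app k (t.app k z) = p.app k (b₀.app k z.1.1)
    obtain ⟨z, hz | ⟨x, rfl⟩ | ⟨x, rfl⟩⟩ := z
    · rw [ht]
      refine (homotopy_const_apply_eq (a ≫ p) k ⟨z.1, hz⟩ z.2
        ((ι₀ (X := (S : SSet.{u}))).app k ⟨z.1, hz⟩).2).trans ?_
      exact congrArg (p.app k) (ConcreteCategory.congr_hom (NatTrans.congr_app h₀ k)
        (⟨z.1, hz⟩ : S.obj k))
    · exact congrArg (p.app k) (ht₀ k x)
    · exact (congrArg (p.app k) (ht₁ k x)).trans (hb' k x).symm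
  obtain ⟨⟨l, hl, -⟩⟩ := hlift.sq_hasLift sq
  have hl' : ∀ k (z : (cylinderSubcomplex S).obj k), l.app k z.1 = t.app k z := fun k z =>
    ConcreteCategory.congr_hom (NatTrans.congr_app hl k) z
  refine ⟨l, ?_, ?_, ?_⟩
  · ext k z
    exact (hl' k ⟨(z.1.1, z.2), Or.inl z.1.2⟩).trans (ht k _ z.1.2)
  · ext k x
    exact (hl' k _).trans (ht₀ k x)
  · ext k x
    exact (hl' k _).trans (ht₁ k x)

variable (Y) in
/-- The starting point of a path. -/
noncomputable def pathSource : (ihom Δ[1]).obj Y ⟶ Y :=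
  ι₀ ≫ (β_ _ _).hom ≫ (ihom.ev Δ[1]).app Y

variable (Y) in
/-- The end point of a path. -/
noncomputable def pathTarget : (ihom Δ[1]).obj Y ⟶ Y :=
  ι₁ ≫ (β_ _ _).hom ≫ (ihom.ev Δ[1]).app Y

/-- Uncurrying puts `Δ[1]` on the left, while cylinders have it on the right; the braiding mediates
between the two. -/
lemma comp_pathSource {K : SSet.{u}} (h : K ⟶ (ihom Δ[1]).obj Y) :
    h ≫ pathSource Y = ι₀ ≫ (β_ _ _).hom ≫ uncurry h := by
  rw [uncurry_eq, pathSource, ← ι₀_comp_assoc, BraidedCategory.braiding_naturality_left_assoc]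

lemma comp_pathTarget {K : SSet.{u}} (h : K ⟶ (ihom Δ[1]).obj Y) :
    h ≫ pathTarget Y = ι₁ ≫ (β_ _ _).hom ≫ uncurry h := by
  rw [uncurry_eq, pathTarget, ← ι₁_comp_assoc, BraidedCategory.braiding_naturality_left_assoc]

lemma pathSource_naturality {Y Y' : SSet.{u}} (f : Y ⟶ Y') :
    (ihom Δ[1]).map f ≫ pathSource Y' = pathSource Y ≫ f := by
  rw [comp_pathSource, uncurry_ihom_map, pathSource, Category.assoc, Category.assoc]

lemma pathTarget_naturality {Y Y' : SSet.{u}} (f : Y ⟶ Y') :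
    (ihom Δ[1]).map f ≫ pathTarget Y' = pathTarget Y ≫ f := by
  rw [comp_pathTarget, uncurry_ihom_map, pathTarget, Category.assoc, Category.assoc]

lemma path_const_eq {A : Type u} (p : Y ⟶ (SimplicialObject.const (Type u)).obj A) :
    pathSource Y ≫ p = pathTarget Y ≫ p := by
  ext k x
  exact homotopy_const_apply_eq ((β_ _ _).hom ≫ (ihom.ev Δ[1]).app Y ≫ p) k x _ _

/-- The homotopy associated with a map to a path object. -/
noncomputable def homotopyOfPath {K : SSet.{u}} {f g : K ⟶ Y} (h : K ⟶ (ihom Δ[1]).obj Y)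
    (hf : h ≫ pathSource Y = f) (hg : h ≫ pathTarget Y = g) : Homotopy f g where
  h := (β_ _ _).hom ≫ uncurry h
  h₀ := (comp_pathSource h).symm.trans hf
  h₁ := (comp_pathTarget h).symm.trans hg
  -- The homotopy is relative to the empty subcomplex.
  rel := by ext k ⟨⟨x, hx⟩, y⟩; exact hx.elim

/-- The path object of a trivial fibration over a constant simplicial set is trivially fibred over
the fibre product. -/
lemma rlp_path {A : Type u} {p : Y ⟶ (SimplicialObject.const (Type u)).obj A}
    (hp : modelCategoryQuillen.I.rlp p) {Z : SSet.{u}} {fst snd : Z ⟶ Y}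
    (hZ : IsPullback fst snd p p) (q : (ihom Δ[1]).obj Y ⟶ Z)
    (hq₀ : q ≫ fst = pathSource Y) (hq₁ : q ≫ snd = pathTarget Y) :
    modelCategoryQuillen.I.rlp q := by
  suffices h : ∀ m, HasLiftingProperty ∂Δ[m].ι q by
    rintro _ _ _ ⟨m⟩
    exact h m
  intro m
  refine ⟨fun {a b} sq => ?_⟩
  -- By currying, the square is a homotopy on `∂Δ[m]` together with extensions of both its ends to
  -- `Δ[m]` that agree after `p`. A lift is an extension of the homotopy with these ends.
  obtain ⟨H, hH, hH₀, hH₁⟩ := exists_homotopy_extension (∂Δ[m]) hp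
    ((β_ _ _).hom ≫ uncurry a) (b ≫ fst) (b ≫ snd)
    (by rw [← comp_pathSource, ← hq₀, sq.w_assoc])
    (by rw [← comp_pathTarget, ← hq₁, sq.w_assoc])
    (by rw [Category.assoc, Category.assoc, hZ.w])
  have hl₀ : curry ((β_ _ _).hom ≫ H) ≫ pathSource Y = b ≫ fst := by
    rw [comp_pathSource, uncurry_curry, SymmetricCategory.symmetry_assoc, hH₀]
  have hl₁ : curry ((β_ _ _).hom ≫ H) ≫ pathTarget Y = b ≫ snd := by
    rw [comp_pathTarget, uncurry_curry, SymmetricCategory.symmetry_assoc, hH₁]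
  refine ⟨⟨⟨curry ((β_ _ _).hom ≫ H), ?_, ?_⟩⟩⟩
  · apply uncurry_injective
    rw [uncurry_natural_left, uncurry_curry, BraidedCategory.braiding_naturality_right_assoc,
      hH, SymmetricCategory.symmetry_assoc]
  · refine hZ.hom_ext ?_ ?_
    · rw [Category.assoc, hq₀, hl₀]
    · rw [Category.assoc, hq₁, hl₁]

end SSet

/-! ### Combinatorial homotopy operators of simplicial sets -/

namespace SSet

open MonoidalCategory MonoidalClosed Simplicial

/-- Homotopies are built separately at each object of `Π`; this naturality and the next one assemble
them into maps of `Π`-algebras. -/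
lemma homotopyOfPath_h_naturality {X Y X' Y' : SSet.{u}} {f g : X ⟶ Y} {f' g' : X' ⟶ Y'}
    {h : X ⟶ (ihom Δ[1]).obj Y} (hf : h ≫ pathSource Y = f) (hg : h ≫ pathTarget Y = g)
    {h' : X' ⟶ (ihom Δ[1]).obj Y'} (hf' : h' ≫ pathSource Y' = f') (hg' : h' ≫ pathTarget Y' = g')
    {a : X ⟶ X'} {b : Y ⟶ Y'} (hab : h ≫ (ihom Δ[1]).map b = a ≫ h') :
    (homotopyOfPath h hf hg).h ≫ b = a ▷ Δ[1] ≫ (homotopyOfPath h' hf' hg').h := by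
  change ((β_ _ _).hom ≫ uncurry h) ≫ b = a ▷ Δ[1] ≫ (β_ _ _).hom ≫ uncurry h'
  rw [BraidedCategory.braiding_naturality_left_assoc, Category.assoc,
    ← uncurry_natural_left, ← uncurry_natural_right, hab]

/-- The `i`-th operator evaluates the homotopy, restricted along the map `Δ[m] ⟶ X` classifying `x`,
on the `i`-th nondegenerate `(m+1)`-simplex of the prism. Naturality reduces to that of the
classifying map. -/
lemma toSimplicialObjectHomotopy_h_naturality {X Y X' Y' : SSet.{u}} {f g : X ⟶ Y}
    {f' g' : X' ⟶ Y'} (H : Homotopy f g) (H' : Homotopy f' g') (a : X ⟶ X') (b : Y ⟶ Y')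
    (hab : H.h ≫ b = a ▷ Δ[1] ≫ H'.h) {m : ℕ} (i : Fin (m + 1)) :
    H.toSimplicialObjectHomotopy.h i ≫ b.app _ = a.app _ ≫ H'.toSimplicialObjectHomotopy.h i := by
  refine ConcreteCategory.hom_ext _ _ fun x => ?_
  change ((yonedaEquiv.symm x ▷ Δ[1] ≫ H.h) ≫ b).app _ _ =
    (yonedaEquiv.symm (a.app _ x) ▷ Δ[1] ≫ H'.h).app _ _
  have : yonedaEquiv.symm (a.app _ x) = yonedaEquiv.symm x ≫ a := by
    apply yonedaEquiv.injective
    rw [Equiv.apply_symm_apply, yonedaEquiv_comp, Equiv.apply_symm_apply]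
  rw [this, Category.assoc, hab, comp_whiskerRight, Category.assoc]

/-- After `p` the `Δ[1]`-coordinate is irrelevant, so the prism simplex may be moved to the end
where the homotopy is `f`. The degrees `m + 1` and `m` of the two sides can be compared because the
constant object has value `A` in both. -/
lemma toSimplicialObjectHomotopy_h_comp_const {X Y : SSet.{u}} {f g : X ⟶ Y} (H : Homotopy f g)
    {A : Type u} (p : Y ⟶ (SimplicialObject.const (Type u)).obj A) {m : ℕ} (i : Fin (m + 1)) :
    H.toSimplicialObjectHomotopy.h i ≫ p.app _ = f.app _ ≫ p.app _ := by
  refine ConcreteCategory.hom_ext _ _ fun x => ?_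
  let z := (prodStdSimplex.nonDegenerateEquiv₁ (p := m) i).1
  change ((yonedaEquiv.symm x ▷ Δ[1] ≫ H.h) ≫ p).app _ (z.1, z.2) = p.app _ (f.app _ x)
  refine (homotopy_const_apply_eq ((yonedaEquiv.symm x ▷ Δ[1] ≫ H.h) ≫ p) _ z.1 z.2
    ((ι₀ (X := Δ[m])).app _ z.1).2).trans ?_
  have h1 : ι₀ ≫ (yonedaEquiv.symm x ▷ Δ[1] ≫ H.h) ≫ p = yonedaEquiv.symm x ≫ f ≫ p := by
    rw [Category.assoc, ι₀_comp_assoc, H.h₀_assoc]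
  refine (ConcreteCategory.congr_hom (NatTrans.congr_app h1 _) z.1).trans ?_
  exact NatTrans.naturality_apply (f ≫ p) (stdSimplex.objEquiv z.1).op x

end SSet

/-! ### Path objects of simplicial `Π`-algebras -/

namespace PiAlgebra

open MonoidalCategory MonoidalClosed Simplicial

/-- The simplicial set of values at an object of `Π` of a simplicial `Π`-algebra. -/
abbrev evalSSet (W : SphereCatᵒᵖ) : SimplicialObject PiAlg.{u} ⥤ SSet.{u} :=
  (SimplicialObject.whiskering _ _).obj (IsPiAlg.ι ⋙ (evaluation _ _).obj W)

/-- A simplicial `Π`-algebra as a functor to simplicial sets. -/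
def toSSetFunctor (Y : SimplicialObject PiAlg.{u}) : SphereCatᵒᵖ ⥤ SSet.{u} :=
  Functor.flip (Y ⋙ IsPiAlg.ι)

instance (Y : SimplicialObject PiAlg.{u}) : PreservesFiniteProducts (toSSetFunctor Y) where
  preserves n := preservesLimitsOfShape_of_evaluation (toSSetFunctor Y) _ fun k =>
    have : PreservesFiniteProducts (Y.obj k).obj := (Y.obj k).property
    inferInstanceAs (PreservesLimitsOfShape (Discrete (Fin n)) (Y.obj k).obj)

/-- The path object of a simplicial `Π`-algebra. -/
noncomputable def pathObj (Y : SimplicialObject PiAlg.{u}) : SimplicialObject PiAlg.{u} :=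
  IsPiAlg.lift (Functor.flip (toSSetFunctor Y ⋙ ihom Δ[1])) fun k => by
    -- As a right adjoint, the internal hom out of `Δ[1]` preserves products, so applying it at each
    -- object of `Π` gives a `Π`-algebra in every simplicial degree.
    have h1 : PreservesFiniteProducts (ihom (Δ[1] : SSet.{u})) :=
      ⟨fun _ => ((ihom.adjunction (Δ[1] : SSet.{u})).rightAdjoint_preservesLimits).1⟩
    have h2 : PreservesFiniteProducts ((evaluation SimplexCategoryᵒᵖ (Type u)).obj k) :=
      ⟨fun _ => inferInstance⟩
    exact ⟨fun n => inferInstanceAs (PreservesLimitsOfShape (Discrete (Fin n))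
      ((toSSetFunctor Y ⋙ ihom Δ[1]) ⋙ (evaluation SimplexCategoryᵒᵖ (Type u)).obj k))⟩

/-- The map of simplicial `Π`-algebras given by a natural family of maps of simplicial sets. -/
def homOfNatTrans {X Y : SimplicialObject PiAlg.{u}}
    (τ : ∀ W, (evalSSet W).obj X ⟶ (evalSSet W).obj Y)
    (hτ : ∀ {W W'} (φ : W ⟶ W'), (toSSetFunctor X).map φ ≫ τ W' = τ W ≫ (toSSetFunctor Y).map φ) :
    X ⟶ Y where
  app k := ObjectProperty.homMk
    { app := fun W => (τ W).app k
      naturality := fun _ _ φ => NatTrans.congr_app (hτ φ) k }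
  naturality k l f := ObjectProperty.hom_ext _ (by
    ext1
    funext W
    exact (τ W).naturality f)

/-- The starting point of a path. -/
noncomputable def pathSource (Y : SimplicialObject PiAlg.{u}) : pathObj Y ⟶ Y :=
  homOfNatTrans (fun W => SSet.pathSource ((evalSSet W).obj Y))
    fun φ => SSet.pathSource_naturality ((toSSetFunctor Y).map φ)

/-- The end point of a path. -/
noncomputable def pathTarget (Y : SimplicialObject PiAlg.{u}) : pathObj Y ⟶ Y :=
  homOfNatTrans (fun W => SSet.pathTarget ((evalSSet W).obj Y))
    fun φ => SSet.pathTarget_naturality ((toSSetFunctor Y).map φ)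

lemma simplicial_hom_ext {X Y : SimplicialObject PiAlg.{u}} {f g : X ⟶ Y}
    (h : ∀ W, (evalSSet W).map f = (evalSSet W).map g) : f = g := by
  ext k : 1
  refine ObjectProperty.hom_ext _ ?_
  ext1
  funext W
  exact NatTrans.congr_app (h W) k

/-- If two maps to a simplicial `Π`-algebra with an acyclic fibration to a constant one agree after
composition with it, and the source is cofibrant, they are connected by a map to the path object. -/
lemma exists_path {X Y : SimplicialObject PiAlg.{u}} (hX : IsCofibrant gradedSet X) {A : PiAlg.{u}}
    {p : Y ⟶ (SimplicialObject.const PiAlg.{u}).obj A} (hp : IsAcyclicFibration gradedSet p)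
    (f g : X ⟶ Y) (hfg : f ≫ p = g ≫ p) :
    ∃ h : X ⟶ pathObj Y, h ≫ pathSource Y = f ∧ h ≫ pathTarget Y = g := by
  have : HasPullbacks (SimplicialObject PiAlg.{u}) :=
    inferInstanceAs (HasPullbacks (SimplexCategoryᵒᵖ ⥤ PiAlg.{u}))
  have hw : pathSource Y ≫ p = pathTarget Y ≫ p := simplicial_hom_ext fun W =>
    SSet.path_const_eq (A := A.obj.obj W) ((evalSSet W).map p)
  -- The endpoint map `Y^Δ[1] ⟶ Y ×_A Y`. Each `gradedSet i` preserves pullbacks, which reduces the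
  -- claim to simplicial sets.
  have hq : IsAcyclicFibration gradedSet (pullback.lift _ _ hw) := by
    intro i
    have : PreservesLimitsOfShape WalkingCospan (gradedSet.{u} i) := by
      unfold gradedSet
      infer_instance
    have : PreservesLimitsOfShape WalkingCospan
        ((SimplicialObject.whiskering _ _).obj (gradedSet.{u} i)) :=
      inferInstanceAs (PreservesLimitsOfShape WalkingCospan
        ((Functor.whiskeringRight SimplexCategoryᵒᵖ _ _).obj (gradedSet.{u} i)))
    refine SSet.rlp_path (A := (gradedSet i).obj A) (hp i) ((IsPullback.of_hasPullback p p).map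
      ((SimplicialObject.whiskering _ _).obj (gradedSet.{u} i))) _ ?_ ?_
    · exact (Functor.map_comp _ _ _).symm.trans (congrArg _ (pullback.lift_fst _ _ hw))
    · exact (Functor.map_comp _ _ _).symm.trans (congrArg _ (pullback.lift_snd _ _ hw))
  obtain ⟨l, hl⟩ := hX _ hq (pullback.lift f g hfg)
  refine ⟨l, ?_, ?_⟩
  · rw [← pullback.lift_fst _ _ hw, ← Category.assoc, hl, pullback.lift_fst]
  · rw [← pullback.lift_snd _ _ hw, ← Category.assoc, hl, pullback.lift_snd]

/-! ### Maps and homotopies over a fixed `Π`-algebra -/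

section Over

variable {A : PiAlg.{u}}

/-- The underlying simplicial `Π`-algebra of a simplicial object over `A`. -/
abbrev overForget (A : PiAlg.{u}) : SimplicialObject (Over A) ⥤ SimplicialObject PiAlg.{u} :=
  (SimplicialObject.whiskering _ _).obj (Over.forget A)

/-- The map of a simplicial object over `A` to the constant simplicial object. -/
abbrev toConst (X : SimplicialObject (Over A)) :
    (overForget A).obj X ⟶ (SimplicialObject.const PiAlg.{u}).obj A where
  app k := (X.obj k).hom
  naturality _ _ f := (Over.w (X.map f)).trans (Category.comp_id _).symm

lemma overForget_map_comp_toConst {X Y : SimplicialObject (Over A)} (f : X ⟶ Y) :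
    (overForget A).map f ≫ toConst Y = toConst X := by
  ext k : 1
  exact Over.w (f.app k)

/-- Maps over `A` which are connected by a map to the path object are homotopic. -/
noncomputable def homotopyOfPath {X Y : SimplicialObject (Over A)} {f g : X ⟶ Y}
    (h : (overForget A).obj X ⟶ pathObj ((overForget A).obj Y))
    (hf : h ≫ pathSource _ = (overForget A).map f)
    (hg : h ≫ pathTarget _ = (overForget A).map g) : SimplicialObject.Homotopy f g :=
  -- One homotopy for each `W`: `hH` makes its operators natural in `W`, and `hp` puts them over
  -- `A`. The simplicial identities then hold because they hold at every `W`.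
  let H : ∀ W, SSet.Homotopy ((evalSSet W).map ((overForget A).map f))
      ((evalSSet W).map ((overForget A).map g)) := fun W =>
    SSet.homotopyOfPath ((evalSSet W).map h)
      (congrArg (evalSSet W).map hf) (congrArg (evalSSet W).map hg)
  have hH : ∀ {W W' : SphereCatᵒᵖ} (φ : W ⟶ W'),
      (H W).h ≫ (toSSetFunctor ((overForget A).obj Y)).map φ =
        (toSSetFunctor ((overForget A).obj X)).map φ ▷ Δ[1] ≫ (H W').h := fun {W W'} φ => by
    refine SSet.homotopyOfPath_h_naturality _ _ _ _ ?_
    exact NatTrans.ext (funext fun k => ((h.app k).hom.naturality φ).symm)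
  have hp : ∀ W {m : ℕ} (i : Fin (m + 1)),
      (H W).toSimplicialObjectHomotopy.h i ≫ ((evalSSet W).map (toConst Y)).app _ =
        ((evalSSet W).map (toConst X)).app _ := fun W {m} i =>
    (SSet.toSimplicialObjectHomotopy_h_comp_const (A := A.obj.obj W) (H W) ((evalSSet W).map (toConst Y)) i).trans
      (NatTrans.congr_app (congrArg (evalSSet W).map (overForget_map_comp_toConst f)) _)
  { h := fun {m} i => Over.homMk (ObjectProperty.homMk
      { app := fun W => (H W).toSimplicialObjectHomotopy.h i
        naturality := fun W W' φ =>
          (SSet.toSimplicialObjectHomotopy_h_naturality (H W) (H W') _ _ (hH φ) i).symm })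
      (ObjectProperty.hom_ext _ (by
        ext1
        funext W
        exact hp W i))
    h_zero_comp_δ_zero := fun m => Over.OverMorphism.ext (ObjectProperty.hom_ext _ (by
      ext1
      funext W
      exact (H W).toSimplicialObjectHomotopy.h_zero_comp_δ_zero m))
    h_last_comp_δ_last := fun m => Over.OverMorphism.ext (ObjectProperty.hom_ext _ (by
      ext1
      funext W
      exact (H W).toSimplicialObjectHomotopy.h_last_comp_δ_last m))
    h_succ_comp_δ_castSucc_of_lt := fun i j hij =>
      Over.OverMorphism.ext (ObjectProperty.hom_ext _ (by
        ext1
        funext W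
        exact (H W).toSimplicialObjectHomotopy.h_succ_comp_δ_castSucc_of_lt i j hij))
    h_succ_comp_δ_castSucc_succ := fun j =>
      Over.OverMorphism.ext (ObjectProperty.hom_ext _ (by
        ext1
        funext W
        exact (H W).toSimplicialObjectHomotopy.h_succ_comp_δ_castSucc_succ j))
    h_castSucc_comp_δ_succ_of_lt := fun i j hij =>
      Over.OverMorphism.ext (ObjectProperty.hom_ext _ (by
        ext1
        funext W
        exact (H W).toSimplicialObjectHomotopy.h_castSucc_comp_δ_succ_of_lt i j hij))
    h_comp_σ_castSucc_of_le := fun i j hij =>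
      Over.OverMorphism.ext (ObjectProperty.hom_ext _ (by
        ext1
        funext W
        exact (H W).toSimplicialObjectHomotopy.h_comp_σ_castSucc_of_le i j hij))
    h_comp_σ_succ_of_lt := fun i j hij =>
      Over.OverMorphism.ext (ObjectProperty.hom_ext _ (by
        ext1
        funext W
        exact (H W).toSimplicialObjectHomotopy.h_comp_σ_succ_of_lt i j hij)) }

/-- Maps over `A` agree after composition to the constant object, which is what the path object
lifting needs. -/
lemma nonempty_homotopy {X : SimplicialObject (Over A)}
    (hX : IsCofibrant gradedSet ((overForget A).obj X)) (P : CofibrantReplacement gradedSet A)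
    (f g : X ⟶ P.res) : Nonempty (SimplicialObject.Homotopy f g) := by
  obtain ⟨h, hf, hg⟩ := exists_path hX P.isAcyclicFibration ((overForget A).map f)
    ((overForget A).map g) ((overForget_map_comp_toConst f).trans
      (overForget_map_comp_toConst g).symm)
  exact ⟨homotopyOfPath h hf hg⟩

/-- The structure map of `X` lifts through the acyclic fibration `P ⟶ A`, and the lifting equation
says that the lift is over `A`. -/
lemma nonempty_hom {X : SimplicialObject (Over A)}
    (hX : IsCofibrant gradedSet ((overForget A).obj X)) (P : CofibrantReplacement gradedSet A) :
    Nonempty (X ⟶ P.res) := by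
  obtain ⟨l, hl⟩ := hX _ P.isAcyclicFibration (toConst X)
  exact ⟨{ app := fun k => Over.homMk (l.app k) (NatTrans.congr_app hl k)
           naturality := fun _ _ f => Over.OverMorphism.ext (l.naturality f) }⟩

end Over

end PiAlgebra

/-! ### From simplicial homotopies to cochain homotopies -/

namespace PiAlgebra

section Cochain

open AlgebraicTopology

universe v₁ v₂ u₁ u₂

variable {D : Type u₁} [Category.{v₁} D] {C : Type u₂} [Category.{v₂} C]

/-- The cosimplicial object obtained by applying a contravariant functor to a simplicial object. -/
abbrev cosimplicialObj (F : Dᵒᵖ ⥤ C) (R : SimplicialObject D) : CosimplicialObject C :=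
  R.rightOp ⋙ F

/-- The map of cosimplicial objects obtained by applying a contravariant functor to a map of
simplicial objects. -/
abbrev cosimplicialMap (F : Dᵒᵖ ⥤ C) {R R' : SimplicialObject D} (f : R ⟶ R') :
    cosimplicialObj F R' ⟶ cosimplicialObj F R :=
  Functor.whiskerRight (NatTrans.rightOp f) F

lemma cosimplicialMap_id (F : Dᵒᵖ ⥤ C) (R : SimplicialObject D) :
    cosimplicialMap F (𝟙 R) = 𝟙 _ :=
  NatTrans.ext (funext fun _ => F.map_id _)

lemma cosimplicialMap_comp (F : Dᵒᵖ ⥤ C) {R R' R'' : SimplicialObject D} (f : R ⟶ R')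
    (g : R' ⟶ R'') : cosimplicialMap F (f ≫ g) = cosimplicialMap F g ≫ cosimplicialMap F f :=
  NatTrans.ext (funext fun _ => F.map_comp _ _)

variable [Preadditive C]

/-- Regarding `F` as a covariant functor to `Cᵒᵖ` makes the cochain complex the opposite of an
alternating face map complex, so the chain homotopy of a simplicial homotopy can be used there. -/
lemma alternatingCofaceMapComplex_d_eq_unop (F : Dᵒᵖ ⥤ C) (R : SimplicialObject D) (m : ℕ) :
    ((alternatingCofaceMapComplex C).obj (cosimplicialObj F R)).d m (m + 1) =
      (((alternatingFaceMapComplex Cᵒᵖ).obj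
        (((SimplicialObject.whiskering D Cᵒᵖ).obj F.rightOp).obj R)).d (m + 1) m).unop := by
  rw [alternatingFaceMapComplex_obj_d]
  refine (CochainComplex.of_d (fun k => (cosimplicialObj F R).obj (SimplexCategory.mk k))
    (AlternatingCofaceMapComplex.objD (cosimplicialObj F R)) m).trans ?_
  rw [AlternatingFaceMapComplex.objD, AlternatingCofaceMapComplex.objD, unop_sum]
  simp only [unop_zsmul]
  rfl

/-- The maps which form the homotopy of cochain complexes associated with a simplicial homotopy. -/
noncomputable def cochainHomotopyHom {R R' : SimplicialObject D} {f g : R ⟶ R'}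
    (H : SimplicialObject.Homotopy f g) (F : Dᵒᵖ ⥤ C) (i j : ℕ) :
    ((alternatingCofaceMapComplex C).obj (cosimplicialObj F R')).X i ⟶
      ((alternatingCofaceMapComplex C).obj (cosimplicialObj F R)).X j :=
  ((H.whiskerRight F.rightOp).toChainHomotopy.hom j i).unop

/-- A contravariant functor to a preadditive category turns simplicial homotopies into homotopies
of cochain complexes. -/
noncomputable def cochainHomotopy {R R' : SimplicialObject D} {f g : R ⟶ R'}
    (H : SimplicialObject.Homotopy f g) (F : Dᵒᵖ ⥤ C) :
    Homotopy ((alternatingCofaceMapComplex C).map (cosimplicialMap F f))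
      ((alternatingCofaceMapComplex C).map (cosimplicialMap F g)) where
  hom := cochainHomotopyHom H F
  zero i j hij := Quiver.Hom.op_inj ((H.whiskerRight F.rightOp).toChainHomotopy.zero _ _ hij)
  comm m := by
    -- Passing to opposites exchanges the `dNext` and `prevD` terms, hence the swap of the first two
    -- summands.
    have h : ∀ {A B : Cᵒᵖ} (a b c : A ⟶ B), (a + b + c).unop = b.unop + a.unop + c.unop :=
      fun a b c => by rw [add_comm a, unop_add, unop_add]
    refine (congrArg Quiver.Hom.unop
      ((H.whiskerRight F.rightOp).toChainHomotopy.comm m)).trans ((h _ _ _).trans ?_)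
    refine congrArg₂ (· + ·) (congrArg₂ (· + ·) ?_ ?_) rfl
    · refine Eq.trans ?_ (Homotopy.dNext_cochainComplex (cochainHomotopyHom H F) m).symm
      rw [alternatingCofaceMapComplex_d_eq_unop, Homotopy.prevD_chainComplex]
      rfl
    · cases m with
      | zero =>
        refine Eq.trans ?_ (Homotopy.prevD_zero_cochainComplex (cochainHomotopyHom H F)).symm
        rw [Homotopy.dNext_zero_chainComplex]
        rfl
      | succ m =>
        refine Eq.trans ?_ (Homotopy.prevD_succ_cochainComplex (cochainHomotopyHom H F) m).symm
        rw [Homotopy.dNext_succ_chainComplex, alternatingCofaceMapComplex_d_eq_unop]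
        rfl

end Cochain

/-! ### Invariance of Quillen cohomology and the comparison map -/

section Comparison

attribute [local instance] Over.cartesianMonoidalCategory Over.braidedCategory

open AlgebraicTopology

/-- The map of cochain complexes of derivations induced by a map of simplicial objects. -/
noncomputable def derivationComplexMap {A : PiAlg.{u}} (M : BeckModule A)
    {X Y : SimplicialObject (Over A)} (f : X ⟶ Y) : derivationComplex M Y ⟶ derivationComplex M X :=
  (alternatingCofaceMapComplex AddCommGrpCat).map (cosimplicialMap (derivations M) f)

lemma homologyMap_derivationComplexMap_eq {A : PiAlg.{u}} (M : BeckModule A)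
    {X : SimplicialObject (Over A)} (hX : IsCofibrant gradedSet ((overForget A).obj X))
    (P : CofibrantReplacement gradedSet A) (f g : X ⟶ P.res) (k : ℕ) :
    HomologicalComplex.homologyMap (derivationComplexMap M f) k =
      HomologicalComplex.homologyMap (derivationComplexMap M g) k :=
  (cochainHomotopy (nonempty_homotopy hX P f g).some (derivations M)).homologyMap_eq k

lemma derivationComplexMap_id {A : PiAlg.{u}} (M : BeckModule A) (X : SimplicialObject (Over A)) :
    derivationComplexMap M (𝟙 X) = 𝟙 _ := by
  rw [derivationComplexMap, cosimplicialMap_id]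
  exact CategoryTheory.Functor.map_id _ _

lemma derivationComplexMap_comp {A : PiAlg.{u}} (M : BeckModule A)
    {X Y Z : SimplicialObject (Over A)} (f : X ⟶ Y) (g : Y ⟶ Z) :
    derivationComplexMap M (f ≫ g) = derivationComplexMap M g ≫ derivationComplexMap M f := by
  rw [derivationComplexMap, cosimplicialMap_comp]
  exact CategoryTheory.Functor.map_comp _ _ _

/-- There is a map back over `A`, and both composites are homotopic to identities because each is a
self-map of a cofibrant replacement. -/
lemma isIso_homologyMap_derivationComplexMap {A : PiAlg.{u}} (M : BeckModule A)
    (P P' : CofibrantReplacement gradedSet A) (f : P.res ⟶ P'.res) (k : ℕ) :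
    IsIso (HomologicalComplex.homologyMap (derivationComplexMap M f) k) := by
  obtain ⟨g⟩ := nonempty_hom P'.isCofibrant P
  refine ⟨HomologicalComplex.homologyMap (derivationComplexMap M g) k, ?_, ?_⟩
  · rw [← HomologicalComplex.homologyMap_comp, ← derivationComplexMap_comp,
      homologyMap_derivationComplexMap_eq M P'.isCofibrant P' _ (𝟙 _), derivationComplexMap_id,
      HomologicalComplex.homologyMap_id]
  · rw [← HomologicalComplex.homologyMap_comp, ← derivationComplexMap_comp,
      homologyMap_derivationComplexMap_eq M P.isCofibrant P _ (𝟙 _), derivationComplexMap_id,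
      HomologicalComplex.homologyMap_id]

/-- Connected covers preserve acyclic fibrations. -/
lemma isAcyclicFibration_connCover (n : ℕ) {E F : SimplicialObject PiAlg.{u}} {p : E ⟶ F}
    (hp : IsAcyclicFibration gradedSet p) :
    IsAcyclicFibration (connGradedSet n)
      (((SimplicialObject.whiskering _ _).obj (connCover n)).map p) := by
  intro i
  by_cases hi : n < i
  -- For `i > n` the counit identifies the map on `S^i` with that of `p`. For `i ≤ n` source and
  -- target are points in every degree, so the map is an isomorphism.
  · let c : connCover n ⋙ connGradedSet.{u} n i ⟶ gradedSet i :=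
      { app := fun A => (gradedSet i).map (connCoverCounit n A)
        naturality := fun _ _ _ => rfl }
    have hc : IsIso c := by
      rw [NatTrans.isIso_iff_isIso_app]
      exact fun A => (isIso_iff_bijective _).2 (bijective_connCoverCounit n A i hi)
    let e := (Functor.whiskeringRight SimplexCategoryᵒᵖ _ _).mapIso (asIso c)
    refine (MorphismProperty.arrow_mk_iso_iff _ (Arrow.isoMk (e.app E) (e.app F) ?_)).2 (hp i)
    exact (e.hom.naturality p).symm
  · have h : ∀ (G : SimplicialObject PiAlg.{u}) (k : SimplexCategoryᵒᵖ), Nonempty (Unique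
        ((connGradedSet n i).obj ((connCover n).obj (G.obj k)))) := fun G k =>
      ((connCover n).obj (G.obj k)).property i (not_lt.1 hi)
    have : IsIso (((SimplicialObject.whiskering _ (Type u)).obj (connGradedSet n i)).map
        (((SimplicialObject.whiskering _ _).obj (connCover n)).map p)) := by
      refine (NatTrans.isIso_iff_isIso_app _).2 fun k => (isIso_iff_bijective _).2 ?_
      obtain ⟨hE⟩ := h E k
      obtain ⟨hF⟩ := h F k
      exact ⟨fun a b _ => (hE.eq_default a).trans (hE.eq_default b).symm,
        fun b => ⟨hE.default, (hF.eq_default _).trans (hF.eq_default b).symm⟩⟩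
    exact MorphismProperty.rlp_of_isIso _ _

/-- The inclusion of connected `Π`-algebras preserves cofibrant objects. -/
lemma isCofibrant_incl (n : ℕ) {X : SimplicialObject (ConnPiAlg.{u} n)}
    (hX : IsCofibrant (connGradedSet n) X) :
    IsCofibrant gradedSet (((SimplicialObject.whiskering _ _).obj (incl n)).obj X) := by
  intro E F p hp g
  -- The lifting problem is transposed across the adjunction applied in each simplicial degree,
  -- solved there, and transposed back.
  let adj := (connCoverAdj.{u} n).whiskerRight SimplexCategoryᵒᵖ
  obtain ⟨l, hl⟩ := hX _ (isAcyclicFibration_connCover n hp) (adj.homEquiv _ _ g)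
  refine ⟨(adj.homEquiv _ _).symm l, ?_⟩
  apply (adj.homEquiv _ _).injective
  rw [← hl]
  exact (adj.homEquiv_naturality_right _ _).trans
    (congrArg (· ≫ _) (Equiv.apply_symm_apply _ _))

/-- A cofibrant replacement among connected `Π`-algebras is a cofibrant replacement among
`Π`-algebras. -/
noncomputable def CofibrantReplacement.incl (n : ℕ) {B : ConnPiAlg.{u} n}
    (Q : CofibrantReplacement (connGradedSet n) B) :
    CofibrantReplacement gradedSet ((PiAlgebra.incl n).obj B) where
  res := ((SimplicialObject.whiskering _ _).obj (Over.post (PiAlgebra.incl n))).obj Q.res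
  isCofibrant := isCofibrant_incl n Q.isCofibrant
  -- By definition `connGradedSet n i` is `gradedSet i` after the inclusion, so both conditions
  -- concern the same maps of simplicial sets.
  isAcyclicFibration := Q.isAcyclicFibration

instance (n : ℕ) {B : ConnPiAlg.{u} n} (M : BeckModule ((incl n).obj B)) :
    IsIso (derivationsComparison n M) := by
  refine (NatTrans.isIso_iff_isIso_app _).2 fun Y => ?_
  exact (ConcreteCategory.isIso_iff_bijective _).2
    ((connCoverOverAdj n B).homEquiv Y.unop M.X).bijective

/-- The isomorphism of cochain complexes of derivations given by the adjunction. -/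
noncomputable def derivationComplexIso (n : ℕ) {B : ConnPiAlg.{u} n}
    (M : BeckModule ((incl n).obj B)) (Q : SimplicialObject (Over B)) :
    derivationComplex M (((SimplicialObject.whiskering _ _).obj (Over.post (incl n))).obj Q) ≅
      derivationComplex (connCoverModule n M) Q :=
  (alternatingCofaceMapComplex AddCommGrpCat).mapIso
    (Functor.isoWhiskerLeft Q.rightOp (asIso (derivationsComparison n M)))

/-- Only the first factor involves `ψ`, and it compares two cofibrant replacements of `ιB`; the
second is an isomorphism already on cochains. -/
lemma comparison_eq (n : ℕ) {B : ConnPiAlg.{u} n} (M : BeckModule ((incl n).obj B))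
    (P : CofibrantReplacement gradedSet ((incl n).obj B))
    (Q : CofibrantReplacement (connGradedSet n) B) (ψ : MapsOver n Q.res P.res) (k : ℕ) :
    comparison n M P Q ψ k =
      HomologicalComplex.homologyMap (derivationComplexMap M ψ) k ≫
        HomologicalComplex.homologyMap (derivationComplexIso n M Q.res).hom k := by
  have h : comparisonComplex n M ψ =
      derivationComplexMap M ψ ≫ (derivationComplexIso n M Q.res).hom :=
    CategoryTheory.Functor.map_comp (alternatingCofaceMapComplex AddCommGrpCat) _ _
  rw [comparison, h, HomologicalComplex.homologyMap_comp]

end Comparison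

end PiAlgebra

theorem theorem4p9 (n : ℕ) (B : PiAlgebra.ConnPiAlg.{u} n)
    (M : PiAlgebra.BeckModule ((PiAlgebra.incl n).obj B))
    (P : PiAlgebra.CofibrantReplacement PiAlgebra.gradedSet ((PiAlgebra.incl n).obj B))
    (Q : PiAlgebra.CofibrantReplacement (PiAlgebra.connGradedSet n) B) :
    Nonempty (PiAlgebra.MapsOver n Q.res P.res) ∧
    (∀ (ψ ψ' : PiAlgebra.MapsOver n Q.res P.res) (k : ℕ),
      PiAlgebra.comparison n M P Q ψ k = PiAlgebra.comparison n M P Q ψ' k) ∧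
    ∀ (ψ : PiAlgebra.MapsOver n Q.res P.res) (k : ℕ),
      IsIso (PiAlgebra.comparison n M P Q ψ k) := by
  refine ⟨PiAlgebra.nonempty_hom Q.incl.isCofibrant P, fun ψ ψ' k => ?_, fun ψ k => ?_⟩
  · rw [PiAlgebra.comparison_eq, PiAlgebra.comparison_eq]
    congr 1
    exact PiAlgebra.homologyMap_derivationComplexMap_eq M Q.incl.isCofibrant P ψ ψ' k
  · rw [PiAlgebra.comparison_eq]
    have := PiAlgebra.isIso_homologyMap_derivationComplexMap M Q.incl P ψ k
    exact IsIso.comp_isIso' this (inferInstanceAs (IsIso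
      ((HomologicalComplex.homologyFunctor AddCommGrpCat _ k).map
        (PiAlgebra.derivationComplexIso n M Q.res).hom)))
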